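/- Let $X=(X^{(1)},\dots,X^{(d)}):[0,T]\to\mathbb{R}^d$ be a continuous path of bounded variation. For a word $L=l_1\cdots l_m$ over $\{1,\dots,d\}$ and $0\le s\le t\le T$ let $$S^{(L)}_{s,t}=\int_{s<u_1<\cdots<u_m<t}dX^{(l_1)}_{u_1}\cdots dX^{(l_m)}_{u_m},\qquad S^{(\emptyset)}_{s,t}=1,$$ and let $\varphi(L)=\tau(a_{l_1}\cdots a_{l_m})$ be the joint moments of $d$ free standard semicircular variables $a_1,\dots,a_d$ in a non-commutative probability space with unital functional $\tau$. Write $\mathrm{i}$ for the imaginary unit. The Schwinger–Dyson kernel is $$K(s,t)=\sum_{L}\mathrm{i}^{|L|}\varphi(L)\,S^{(L)}_{s,t},$$ the sum being over all words $L$, and, for words $I,J$, the $(I,J)$-component of $K$ as a jointly controlled path is $$K^{(I,J)}(s,t)=(-1)^{|I|}\sum_{L}\mathrm{i}^{|L|+|I|+|J|}\varphi(JLI)\,S^{(L)}_{s,t}.$$ Put $K^{(I)}:=K^{(\emptyset,I)}$ (the components in the second variable). For a word $J=j_1\cdots j_m$ set $K_\emptyset:=K$ and $$K_J(s,t)=(-1)^m\int_{s<u_1<\cdots<u_m<t}K(s,u_1)K(u_1,u_2)\cdots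 K(u_{m-1},u_m)K(u_m,t)\,dX^{(j_1)}_{u_1}\cdots dX^{(j_m)}_{u_m}.$$ Let $NC(n)$ be the set of non-crossing partial matchings of $\{1,\dots,n\}$ given by $NC(0)=\{\emptyset\}$ and $$NC(n)=\{\pi\cup\{\{n\}\}:\pi\in NC(n-1)\}\cup\{(\pi\setminus\{\{m\}\})\cup\{\{m,n\}\}:\pi\in NC(n-1),\ U(\pi)\neq\emptyset,\ m=\max U(\pi)\},$$ where $U(\pi)=\{U_1<\cdots<U_r\}$ is the set of unmatched points and $P(\pi)$ the set of pairs of $\pi$. Proposition. All the integrals above are integrals of integrable functions, the series defining $K^{(I)}(s,t)$ converges absolutely for every word $I$, and for every $0\le s\le t\le T$ and every word $I=i_1\cdots i_n$ (in particular for every word with $n\le\kappa-1$, for any level $\kappa$ at which $K$ is regarded as a controlled path), $$K^{(i_1\cdots i_n)}(s,t)=\sum_{\pi\in NC(n)}\Big(\prod_{(p,q)\in P(\pi)}(-1)\,\delta_{i_p,i_q}\Big)K_{i_{U_r},\dots,i_{U_1}}(s,t),$$ and, equivalently, $$K^{(i_n\cdots i_1)}(s,t)=\sum_{\pi\in NC(n)}\Big(\prod_{(p,q)\in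 P(\pi)}(-1)\,\delta_{i_p,i_q}\Big)K_{i_{U_1},\dots,i_{U_r}}(s,t).$$ -/

import Mathlib

open Set MeasureTheory

/-! ### Non-crossing partial matchings -/

/-- The unmatched points of `π`, i.e. the points `k` whose block is the singleton `{k}`. -/
def unmatchedPoints (π : Finset (Finset ℕ)) : Finset ℕ :=
  (π.biUnion id).filter fun k => {k} ∈ π

/-- The pairs of `π`, i.e. its blocks with two elements. -/
def matchedPairs (π : Finset (Finset ℕ)) : Finset (Finset ℕ) :=
  π.filter fun B => B.card = 2

/-- The set `NC(n)` of non-crossing partial matchings. A matching is the set of its blocks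
(singletons and pairs); the `n` points are numbered `0, …, n - 1`, so the point added in the step
from `n` to `n + 1` is `n`. It is either left unmatched, or paired with the largest unmatched point
(if there is one). -/
def partialMatchingsNC : ℕ → Finset (Finset (Finset ℕ))
  | 0 => {∅}
  | n + 1 =>
    (partialMatchingsNC n).image (fun π => insert {n} π) ∪
      (partialMatchingsNC n).biUnion fun π =>
        if h : (unmatchedPoints π).Nonempty then
          {insert {(unmatchedPoints π).max' h, n} (π.erase {(unmatchedPoints π).max' h})}
        else ∅

/-- The weight `∏ (-1) δ_{i_p, i_q}` over the pairs `{p, q}` of `π`, for the word `I`. -/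
def matchingWeight {d : ℕ} (I : List (Fin d)) (π : Finset (Finset ℕ)) : ℂ :=
  ∏ B ∈ matchedPairs π, if ∀ p ∈ B, ∀ q ∈ B, I[p]? = I[q]? then -1 else 0

/-- The word formed by the letters of `I` at the unmatched points `U₁ < ⋯ < U_r` of `π`, listed in
increasing order of the points. -/
def unmatchedWord {d : ℕ} (I : List (Fin d)) (π : Finset (Finset ℕ)) : List (Fin d) :=
  ((unmatchedPoints π).sort (· ≤ ·)).filterMap fun k => I[k]?

/-! ### Free semicircular variables -/

section Free

variable {A : Type*} [Ring A] [Algebra ℂ A]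

/-- `a` is a standard semicircular variable with respect to `τ`: its odd moments vanish and its
moment of order `2 k` is the `k`-th Catalan number. -/
def IsStandardSemicircular (τ : A →ₗ[ℂ] ℂ) (a : A) : Prop :=
  ∀ n : ℕ, τ (a ^ n) = if Even n then (catalan (n / 2) : ℂ) else 0

/-- The variables `a i` are free with respect to `τ`: `τ` vanishes on every non-empty product of
`τ`-centred elements of the unital subalgebras generated by the single `a i`, as soon as
neighbouring factors come from different subalgebras. -/
def AreFree {ι : Type*} (τ : A →ₗ[ℂ] ℂ) (a : ι → A) : Prop :=
  ∀ l : List (ι × A), l ≠ [] →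
    l.IsChain (fun x y => x.1 ≠ y.1) →
    (∀ x ∈ l, x.2 ∈ Algebra.adjoin ℂ {a x.1} ∧ τ x.2 = 0) →
    τ (l.map Prod.snd).prod = 0

/-- The joint moment `φ(L) = τ(a_{l₁} ⋯ a_{l_m})` of the word `L = l₁ … l_m`. -/
def jointMoment {ι : Type*} (τ : A →ₗ[ℂ] ℂ) (a : ι → A) (L : List ι) : ℂ :=
  τ (L.map a).prod

end Free

/-! ### Integration along a path of bounded variation -/

noncomputable section

open Classical in
/-- The signed Lebesgue–Stieltjes measure `dx` on `ℝ` of a real function `x` of bounded variation on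
`[0, T]`, where `x` is continued by constants outside `[0, T]`. If `x` is continuous on `[0, T]`,
the mass of `(s, t] ⊆ [0, T]` is `x t - x s`. -/
def stieltjesMeasure (T : ℝ) (x : ℝ → ℝ) : SignedMeasure ℝ :=
  if h : BoundedVariationOn (fun u => x (max 0 (min u T))) univ then h.vectorMeasure else 0

/-- The signed measure `dX^{(j)}` of the `j`-th coordinate of `X`. -/
def coordMeasure {d : ℕ} (T : ℝ) (X : ℝ → EuclideanSpace ℝ (Fin d)) (j : Fin d) :
    SignedMeasure ℝ :=
  stieltjesMeasure T fun u => X u j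

/-- The coordinate `S^{(L)}_{s,t} = ∫_{s < u₁ < ⋯ < u_m < t} dX^{(l₁)}_{u₁} ⋯ dX^{(l_m)}_{u_m}` of
the signature of `X`, as the iterated integral whose outermost variable is `u₁`. -/
def signatureCoord {d : ℕ} (T : ℝ) (X : ℝ → EuclideanSpace ℝ (Fin d)) :
    List (Fin d) → ℝ → ℝ → ℝ
  | [], _, _ => 1
  | l :: L, s, t => ∫ᵛ u in Ioc s t, signatureCoord T X L u t ∂<•(coordMeasure T X l)

/-! ### The Schwinger–Dyson kernel

In the following definitions `φ` is a function on words, to be specialised to the joint moments of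
free standard semicircular variables. -/

variable {d : ℕ} (φ : List (Fin d) → ℂ) (T : ℝ) (X : ℝ → EuclideanSpace ℝ (Fin d))

/-- The kernel `K(s,t) = ∑_L i^{|L|} φ(L) S^{(L)}_{s,t}`. -/
def sdKernel (s t : ℝ) : ℂ :=
  ∑' L : List (Fin d), Complex.I ^ L.length * φ L * (signatureCoord T X L s t : ℂ)

/-- The term of the word `L` in the series for the component `K^{(I,J)}(s,t)`. -/
def sdComponentTerm (I J : List (Fin d)) (s t : ℝ) (L : List (Fin d)) : ℂ :=
  (-1) ^ I.length * (Complex.I ^ (L.length + I.length + J.length) * φ (J ++ L ++ I) *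
    (signatureCoord T X L s t : ℂ))

/-- The component `K^{(I,J)}(s,t) = (-1)^{|I|} ∑_L i^{|L|+|I|+|J|} φ(JLI) S^{(L)}_{s,t}` of the
kernel `K` as a jointly controlled path; `I` belongs to the variable `s` and `J` to `t`. -/
def sdComponent (I J : List (Fin d)) (s t : ℝ) : ℂ :=
  ∑' L : List (Fin d), sdComponentTerm φ T X I J s t L

/-- The iterated integral
`∫_{s < u₁ < ⋯ < u_m < t} K(s,u₁) K(u₁,u₂) ⋯ K(u_m,t) dX^{(j₁)}_{u₁} ⋯ dX^{(j_m)}_{u_m}`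
with outermost variable `u₁`; it is `K(s,t)` for the empty word. -/
def sdIterated : List (Fin d) → ℝ → ℝ → ℂ
  | [], s, t => sdKernel φ T X s t
  | j :: J, s, t =>
    ∫ᵛ u in Ioc s t, (sdKernel φ T X s u * sdIterated J u t) ∂<•(coordMeasure T X j)

/-- `K_J(s,t) = (-1)^m ∫ K(s,u₁) ⋯ K(u_m,t) dX^{(j₁)}_{u₁} ⋯ dX^{(j_m)}_{u_m}`, with
`K_∅ = K`. -/
def sdAux (J : List (Fin d)) (s t : ℝ) : ℂ :=
  (-1) ^ J.length * sdIterated φ T X J s t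

end

/-! The claim is reduced to an identity between coefficients of series `∑ c(L) S^{(L)}`. The
splitting S^{(AjB)}_{s,t} = ∫ S^{(A)}_{s,u} S^{(B)}_{u,t} dX^{(j)}_u (`signatureCoord_append_cons`)
turns integration of a product of two such series against dX^{(j)} into the convolution `wordConv j`
of their coefficients (`integral_signatureSeries_mul`). With k(L) = i^{|L|} φ(L), the function K_J
therefore has the coefficients `auxCoeff k J`, an iterated convolution of k, while K^{(I)} has the
coefficients k(IL).

The probabilistic input is the Schwinger–Dyson equation φ(iL) = ∑_{L=AiB} φ(A)φ(B)
(`jointMoment_cons`) and its mirror image for φ(Li), both consequences of freeness and the Catalan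
recursion. Since the square of the imaginary unit is -1, k(iL) and k(Li) both equal minus the
convolution of k with itself at i. Hence prepending i to the argument of `auxCoeff k J` produces the
term with i put in front of J and, if J begins with i, minus the term with that letter deleted
(`auxCoeff_cons`). This is the recursion of NC(n): the new point stays unmatched or is paired with
the last unmatched one. Induction on I gives `coeff_append_eq_sum`; for the reversed word,
`coeff_reverse_append_eq_sum`, the new letter is rotated to the other end of the argument and
`auxCoeff_append_singleton` is used instead.

Convergence rests on |φ(L)| ≤ 4^{|L|} and |S^{(L)}| ≤ V^{|L|}/|L|!, where V is the total mass of the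
sum of the variations of the coordinate measures. As there are d^n words of length n, the series
converge absolutely, uniformly in (s,t), and can be integrated term by term. -/

/-! ### Splitting words at a letter -/

section Words

variable {ι : Type*} [DecidableEq ι]

/-- The pairs `(A, B)` with `L = A j B`. -/
def wordSplits (j : ι) : List ι → Finset (List ι × List ι)
  | [] => ∅
  | l :: L =>
    (if l = j then {([], L)} else ∅) ∪ (wordSplits j L).image fun p => (l :: p.1, p.2)

theorem mem_wordSplits {j : ι} {L : List ι} {p : List ι × List ι} :
    p ∈ wordSplits j L ↔ p.1 ++ j :: p.2 = L := by
  induction L generalizing p with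
  | nil => simp [wordSplits]
  | cons l L ih =>
    rcases p with ⟨A, B⟩
    simp only [wordSplits, Finset.mem_union, Finset.mem_image, Prod.exists, Prod.mk.injEq]
    cases A with
    | nil =>
      by_cases h : l = j
      · simp [h]
      · simp [h, Ne.symm h]
    | cons x A =>
      have : ((x :: A, B) : List ι × List ι) ∉
          (if l = j then ({([], L)} : Finset (List ι × List ι)) else ∅) := by
        split_ifs <;> simp
      simp only [this, false_or, List.cons_append, List.cons.injEq]
      constructor
      · rintro ⟨A', B', h, ⟨rfl, rfl⟩, rfl⟩
        exact ⟨rfl, ih.1 h⟩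
      · rintro ⟨rfl, h⟩
        exact ⟨A, B, ih.2 h, ⟨rfl, rfl⟩, rfl⟩

/-- `∑ c A * c' B` over the splittings `L = A j B`. -/
def wordConv (j : ι) (c c' : List ι → ℂ) (L : List ι) : ℂ :=
  ∑ p ∈ wordSplits j L, c p.1 * c' p.2

@[simp] theorem wordConv_nil (j : ι) (c c' : List ι → ℂ) : wordConv j c c' [] = 0 := rfl

theorem wordConv_cons (j l : ι) (c c' : List ι → ℂ) (L : List ι) :
    wordConv j c c' (l :: L) =
      (if l = j then c [] * c' L else 0) + wordConv j (fun A => c (l :: A)) c' L := by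
  rw [wordConv, wordSplits, Finset.sum_union, Finset.sum_image]
  · congr 1
    split_ifs <;> simp
  · rintro ⟨A, B⟩ _ ⟨A', B'⟩ _ h
    simpa using h
  · rw [Finset.disjoint_left]
    intro p hp hp'
    obtain ⟨q, -, rfl⟩ := Finset.mem_image.1 hp'
    split_ifs at hp <;> simp at hp

theorem wordConv_add_left (j : ι) (c₁ c₂ c' : List ι → ℂ) (L : List ι) :
    wordConv j (fun A => c₁ A + c₂ A) c' L = wordConv j c₁ c' L + wordConv j c₂ c' L := by
  simp [wordConv, add_mul, Finset.sum_add_distrib]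

theorem wordConv_mul_left (j : ι) (x : ℂ) (c c' : List ι → ℂ) (L : List ι) :
    wordConv j (fun A => x * c A) c' L = x * wordConv j c c' L := by
  simp [wordConv, mul_assoc, Finset.mul_sum]

theorem wordConv_sub_left (j : ι) (c₁ c₂ c' : List ι → ℂ) (L : List ι) :
    wordConv j (fun A => c₁ A - c₂ A) c' L = wordConv j c₁ c' L - wordConv j c₂ c' L := by
  simp [wordConv, sub_mul, Finset.sum_sub_distrib]

theorem wordConv_neg_left (j : ι) (c c' : List ι → ℂ) (L : List ι) :
    wordConv j (fun A => -c A) c' L = -wordConv j c c' L := by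
  simp [wordConv]

theorem wordConv_sub_right (j : ι) (c c₁ c₂ : List ι → ℂ) (L : List ι) :
    wordConv j c (fun A => c₁ A - c₂ A) L = wordConv j c c₁ L - wordConv j c c₂ L := by
  simp [wordConv, mul_sub, Finset.sum_sub_distrib]

theorem wordConv_neg_right (j : ι) (c c' : List ι → ℂ) (L : List ι) :
    wordConv j c (fun A => -c' A) L = -wordConv j c c' L := by
  simp [wordConv]

theorem wordConv_mul_right (j : ι) (x : ℂ) (c c' : List ι → ℂ) (L : List ι) :
    wordConv j c (fun A => x * c' A) L = x * wordConv j c c' L := by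
  simp only [wordConv, Finset.mul_sum]
  exact Finset.sum_congr rfl fun _ _ => by ring

/-- The marked letter lies either in the left or in the right word. -/
theorem wordConv_append (j : ι) (c c' : List ι → ℂ) (L L' : List ι) :
    wordConv j c c' (L ++ L') =
      wordConv j c (fun B => c' (B ++ L')) L + wordConv j (fun A => c (L ++ A)) c' L' := by
  induction L generalizing c with
  | nil => simp
  | cons l L ih =>
    simp only [List.cons_append, wordConv_cons, ih]
    ring

theorem wordConv_append_singleton (j i : ι) (c c' : List ι → ℂ) (L : List ι) :
    wordConv j c c' (L ++ [i]) =
      wordConv j c (fun B => c' (B ++ [i])) L + if i = j then c L * c' [] else 0 := by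
  rw [wordConv_append, wordConv_cons]
  simp

/-- Both sides run over the double splittings L = A i B j C. -/
theorem wordConv_assoc (i j : ι) (c c' c'' : List ι → ℂ) (L : List ι) :
    wordConv i c (wordConv j c' c'') L = wordConv j (wordConv i c c') c'' L := by
  induction L generalizing c with
  | nil => simp
  | cons l L ih =>
    simp only [wordConv_cons, ih, wordConv_nil, zero_mul, ite_self, zero_add, wordConv_add_left]
    congr 1
    split_ifs
    · rw [wordConv_mul_left]
    · simp [wordConv]

/-- Each position of the marked letter gives at most one splitting and determines the lengths of
both parts. -/
theorem norm_wordConv_le (j : ι) (c c' : List ι → ℂ) (a b : ℕ → ℝ) (L : List ι)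
    (hc : ∀ A : List ι, A.length < L.length → ‖c A‖ ≤ a A.length)
    (hc' : ∀ A : List ι, A.length < L.length → ‖c' A‖ ≤ b A.length) :
    ‖wordConv j c c' L‖ ≤ ∑ k ∈ Finset.range L.length, a k * b (L.length - 1 - k) := by
  induction L generalizing c a with
  | nil => simp
  | cons l L ih =>
    rw [wordConv_cons, List.length_cons, Finset.sum_range_succ', add_comm]
    refine (norm_add_le _ _).trans (add_le_add ?_ ?_)
    · refine (ih (fun A => c (l :: A)) (fun k => a (k + 1)) ?_ ?_).trans_eq ?_
      · intro A hA
        simpa using hc (l :: A) (by simpa using hA)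
      · intro A hA
        exact hc' A (hA.trans (by simp))
      · refine Finset.sum_congr rfl fun k hk => ?_
        congr 2
        have := Finset.mem_range.1 hk
        omega
    · have h0 := hc [] (by simp)
      have h1 := hc' L (by simp)
      simp only [List.length_nil] at h0
      split_ifs
      · rw [norm_mul]
        simpa using mul_le_mul h0 h1 (norm_nonneg _) ((norm_nonneg _).trans h0)
      · simpa using mul_nonneg ((norm_nonneg _).trans h0) ((norm_nonneg _).trans h1)

/-- The function `c` on words grows at most exponentially in the length. -/
def ExpBounded (c : List ι → ℂ) : Prop :=
  ∃ C R : ℝ, 0 ≤ C ∧ 1 ≤ R ∧ ∀ L, ‖c L‖ ≤ C * R ^ L.length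

omit [DecidableEq ι] in
theorem ExpBounded.neg {c : List ι → ℂ} (hc : ExpBounded c) : ExpBounded fun L => -c L := by
  simpa [ExpBounded] using hc

theorem ExpBounded.wordConv {c c' : List ι → ℂ} (hc : ExpBounded c) (hc' : ExpBounded c') (j : ι) :
    ExpBounded (wordConv j c c') := by
  obtain ⟨C, R, hC, hR, h⟩ := hc
  obtain ⟨C', R', hC', hR', h'⟩ := hc'
  -- The factor 2 absorbs the number of splittings, at most |L| ≤ 2^|L|.
  refine ⟨C * C', R * R' * 2, by positivity, by nlinarith, fun L => ?_⟩
  refine (norm_wordConv_le j c c' (fun n => C * R ^ n) (fun n => C' * R' ^ n) L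
    (fun A _ => h A) fun A _ => h' A).trans ?_
  calc _ ≤ ∑ k ∈ Finset.range L.length, C * C' * (R * R') ^ L.length := by
        refine Finset.sum_le_sum fun k hk => ?_
        have hk := Finset.mem_range.1 hk
        have h1 : R ^ k ≤ R ^ L.length := pow_le_pow_right₀ hR hk.le
        have h2 : R' ^ (L.length - 1 - k) ≤ R' ^ L.length := pow_le_pow_right₀ hR' (by omega)
        rw [mul_pow]
        calc _ = C * C' * (R ^ k * R' ^ (L.length - 1 - k)) := by ring
          _ ≤ _ := by gcongr
    _ = C * C' * ((R * R') ^ L.length * L.length) := by simp; ring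
    _ ≤ C * C' * ((R * R') ^ L.length * 2 ^ L.length) := by
        have : (L.length : ℝ) ≤ 2 ^ L.length := by exact_mod_cast Nat.lt_two_pow_self.le
        gcongr
    _ = _ := by rw [mul_pow (R * R')]

/-- The coefficient function of `K_J` as a series of iterated integrals. -/
def auxCoeff (k : List ι → ℂ) : List ι → List ι → ℂ
  | [] => k
  | j :: J => fun L => -wordConv j k (auxCoeff k J) L

theorem ExpBounded.auxCoeff {k : List ι → ℂ} (hk : ExpBounded k) (J : List ι) :
    ExpBounded (auxCoeff k J) := by
  induction J with
  | nil => exact hk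
  | cons j J ih => exact (hk.wordConv ih j).neg

theorem auxCoeff_nil_right {k : List ι → ℂ} (hk : k [] = 1) (J : List ι) :
    auxCoeff k J [] = if J = [] then 1 else 0 := by
  cases J <;> simp [auxCoeff, hk]

/-- The leading letter is either the letter marked by the outermost convolution, which gives the
deletion term because `k [] = 1`, or it belongs to the first factor k. There `hl` splits at i, and
associativity makes this new splitting the outermost one. -/
theorem auxCoeff_cons {k : List ι → ℂ} (hk : k [] = 1)
    (hl : ∀ i L, k (i :: L) = -wordConv i k k L) (J : List ι) (i : ι) (L : List ι) :
    auxCoeff k J (i :: L) =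
      auxCoeff k (i :: J) L - if J.head? = some i then auxCoeff k J.tail L else 0 := by
  cases J with
  | nil => simp [auxCoeff, hl]
  | cons j J =>
    simp only [auxCoeff, wordConv_cons, hk, one_mul, hl, wordConv_neg_left, wordConv_neg_right,
      List.head?_cons, Option.some.injEq, List.tail_cons]
    have := wordConv_assoc i j k k (auxCoeff k J) L
    change wordConv i k (wordConv j k (auxCoeff k J)) L =
      wordConv j (fun A => wordConv i k k A) (auxCoeff k J) L at this
    rw [← this]
    simp only [eq_comm (a := i) (b := j)]
    change _ = - -wordConv i k (wordConv j k (auxCoeff k J)) L - _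
    ring

/-- The appended letter is passed on to the last factor by induction. The boundary term contains
`auxCoeff k J []`, which vanishes unless J is empty, so only the last letter of the word can be
deleted. -/
theorem auxCoeff_append_singleton {k : List ι → ℂ} (hk : k [] = 1)
    (hr : ∀ i L, k (L ++ [i]) = -wordConv i k k L) (J : List ι) (i : ι) (L : List ι) :
    auxCoeff k J (L ++ [i]) =
      auxCoeff k (J ++ [i]) L -
        if J.getLast? = some i then auxCoeff k J.dropLast L else 0 := by
  induction J generalizing L with
  | nil => simp [auxCoeff, hr]
  | cons j J ih =>
    simp only [auxCoeff, wordConv_append_singleton, List.cons_append]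
    simp only [ih, auxCoeff_nil_right hk, wordConv_sub_right]
    cases J with
    | nil =>
      have : wordConv j k (fun _ => 0) L = 0 := by simp [wordConv]
      simp only [List.getLast?_nil, reduceCtorEq, if_false, this, auxCoeff, List.dropLast,
        List.getLast?_singleton, Option.some.injEq, eq_comm (a := i)]
      split_ifs <;> (simp [auxCoeff]; try ring)
    | cons j' J' =>
      simp only [List.getLast?_cons_cons, reduceCtorEq, if_false, List.dropLast, mul_zero, ite_self,
        add_zero]
      split_ifs
      · simp only [auxCoeff]; ring
      · simp [wordConv]

end Words

/-! ### Joint moments of free semicircular variables -/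

section Centring

variable {ι : Type*} [DecidableEq ι]

/-- The centring of a function on words (extended linearly) in a leading power of the letter
`b.1`: it evaluates `f` at `(x ^ n - m n) W`, for the block `b = (x, n)`. -/
def centreBlock (m : ℕ → ℂ) (b : ι × ℕ) (f : List ι → ℂ) (W : List ι) : ℂ :=
  f (List.replicate b.2 b.1 ++ W) - m b.2 * f W

/-- The evaluation of `f` at `(x₁ ^ n₁ - m n₁) ⋯ (x_r ^ n_r - m n_r) W`. -/
def centreBlocks (m : ℕ → ℂ) : List (ι × ℕ) → (List ι → ℂ) → List ι → ℂ
  | [], f => f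
  | b :: bs, f => centreBlocks m bs (centreBlock m b f)

omit [DecidableEq ι] in
theorem centreBlocks_append (m : ℕ → ℂ) (bs cs : List (ι × ℕ)) (f : List ι → ℂ) :
    centreBlocks m (bs ++ cs) f = centreBlocks m cs (centreBlocks m bs f) := by
  induction bs generalizing f with
  | nil => rfl
  | cons b bs ih => exact ih _

omit [DecidableEq ι] in
theorem centreBlocks_add (m : ℕ → ℂ) (bs : List (ι × ℕ)) (f g : List ι → ℂ) :
    centreBlocks m bs (fun W => f W + g W) =
      fun W => centreBlocks m bs f W + centreBlocks m bs g W := by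
  induction bs generalizing f g with
  | nil => rfl
  | cons b bs ih =>
    simp only [centreBlocks, ← ih]
    congr 1
    funext W
    simp only [centreBlock]
    ring

omit [DecidableEq ι] in
theorem centreBlocks_mul (m : ℕ → ℂ) (bs : List (ι × ℕ)) (x : ℂ) (f : List ι → ℂ) :
    centreBlocks m bs (fun W => x * f W) = fun W => x * centreBlocks m bs f W := by
  induction bs generalizing f with
  | nil => rfl
  | cons b bs ih =>
    simp only [centreBlocks, ← ih]
    congr 1
    funext W
    simp only [centreBlock]
    ring

omit [DecidableEq ι] in
theorem centreBlocks_sub (m : ℕ → ℂ) (bs : List (ι × ℕ)) (f g : List ι → ℂ) :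
    centreBlocks m bs (fun W => f W - g W) =
      fun W => centreBlocks m bs f W - centreBlocks m bs g W := by
  have h := centreBlocks_add m bs f fun W => -1 * g W
  simp only [centreBlocks_mul] at h
  simpa [sub_eq_add_neg] using h

omit [DecidableEq ι] in
theorem centreBlocks_sum {κ : Type*} (m : ℕ → ℂ) (bs : List (ι × ℕ)) (s : Finset κ)
    (f : κ → List ι → ℂ) :
    centreBlocks m bs (fun W => ∑ x ∈ s, f x W) =
      fun W => ∑ x ∈ s, centreBlocks m bs (f x) W := by
  classical
  induction s using Finset.induction_on with
  | empty =>
    simpa using centreBlocks_mul m bs 0 fun _ => 0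
  | insert x s hx ih => simp only [Finset.sum_insert hx, centreBlocks_add, ih]

omit [DecidableEq ι] in
theorem centreBlocks_zero (m : ℕ → ℂ) (bs : List (ι × ℕ)) (W : List ι) :
    centreBlocks m bs (fun _ => 0) W = 0 := by
  simpa using congrFun (centreBlocks_mul m bs 0 fun _ => 0) W

omit [DecidableEq ι] in
theorem centreBlocks_cons (m : ℕ → ℂ) (b : ι × ℕ) (bs : List (ι × ℕ)) (f : List ι → ℂ)
    (W : List ι) :
    centreBlocks m (b :: bs) f W =
      centreBlocks m bs (fun W => f (List.replicate b.2 b.1 ++ W)) W -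
        m b.2 * centreBlocks m bs f W := by
  rw [centreBlocks]
  unfold centreBlock
  rw [centreBlocks_sub, centreBlocks_mul]

/-- Neighbouring blocks have different letters. -/
def AlternatingBlocks (bs : List (ι × ℕ)) : Prop := bs.IsChain fun x y => x.1 ≠ y.1

-- Alternating products of centred powers span all words. A leading letter x is itself a centred
-- block as `m 1 = 0`; if the next block has the same letter, x(x^n - m n) = (x^(n+1) - m (n+1)) + m
-- (n+1) - (m n) x reduces to known cases.
omit [DecidableEq ι] in
theorem eq_zero_of_centreBlocks {m : ℕ → ℂ} (hm1 : m 1 = 0) (L : List ι)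
    {f : List ι → ℂ} (hf : ∀ bs, AlternatingBlocks bs → centreBlocks m bs f [] = 0) : f L = 0 := by
  classical
  induction L generalizing f with
  | nil => exact hf [] List.isChain_nil
  | cons l L ih =>
    refine ih (f := fun W => f (l :: W)) ?_
    have key : ∀ bs, AlternatingBlocks ((l, 1) :: bs) →
        centreBlocks m bs (fun W => f (l :: W)) [] = 0 := by
      intro bs h
      have := hf _ h
      simpa [centreBlocks_cons, hm1] using this
    intro bs hbs
    cases bs with
    | nil => exact key [] (List.isChain_singleton _)
    | cons b bs =>
      obtain ⟨k, n⟩ := b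
      by_cases hk : l = k
      · subst hk
        have h1 : AlternatingBlocks ((l, n + 1) :: bs) := by
          cases bs with
          | nil => exact List.isChain_singleton _
          | cons b bs =>
            have := List.isChain_cons_cons.1 hbs
            exact List.isChain_cons_cons.2 this
        have h2 : AlternatingBlocks ((l, 1) :: bs) := by
          cases bs with
          | nil => exact List.isChain_singleton _
          | cons b bs =>
            have := List.isChain_cons_cons.1 hbs
            exact List.isChain_cons_cons.2 this
        have h3 : AlternatingBlocks bs := hbs.tail
        have e1 := hf _ h1
        have e2 := key _ h2
        have e3 := hf _ h3
        simp only [centreBlocks_cons] at e1 ⊢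
        simp only [e3, e2, mul_zero, sub_zero, List.replicate_succ, List.cons_append] at e1 ⊢
        exact e1
      · exact key _ (List.isChain_cons_cons.2 ⟨hk, hbs⟩)

theorem wordConv_replicate_of_ne {i k : ι} (h : k ≠ i) (f g : List ι → ℂ) (n : ℕ) :
    wordConv i f g (List.replicate n k) = 0 := by
  induction n generalizing f with
  | zero => rfl
  | succ n ih => simp [List.replicate_succ, wordConv_cons, h, ih]

theorem wordConv_replicate_self (i : ι) (f g : List ι → ℂ) (n : ℕ) :
    wordConv i f g (List.replicate n i) =
      ∑ a ∈ Finset.range n, f (List.replicate a i) * g (List.replicate (n - 1 - a) i) := by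
  induction n generalizing f with
  | zero => rfl
  | succ n ih =>
    simp only [List.replicate_succ, wordConv_cons, if_true, ih, Finset.sum_range_succ',
      add_tsub_cancel_right]
    rw [add_comm]
    congr 1
    refine Finset.sum_congr rfl fun k hk => ?_
    have := Finset.mem_range.1 hk
    rw [show n - (k + 1) = n - 1 - k by omega]

theorem centreBlock_wordConv (m : ℕ → ℂ) (b : ι × ℕ) (i : ι) (f g : List ι → ℂ) :
    centreBlock m b (wordConv i f g) = fun W =>
      wordConv i f (fun B => g (B ++ W)) (List.replicate b.2 b.1) +
        wordConv i (centreBlock m b f) g W := by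
  funext W
  have : centreBlock m b f = fun A => f (List.replicate b.2 b.1 ++ A) - m b.2 * f A := rfl
  rw [this, centreBlock, wordConv_append, wordConv_sub_left, wordConv_mul_left]
  ring

variable {m : ℕ → ℂ} {φ : List ι → ℂ}

/-- The convolution is φ ⊗ φ applied to the free difference quotient in the letter i. A splitting
inside a later block leaves on the left a non-empty centred prefix times a bare power; this power is
a centred one plus a scalar, so freeness annihilates the left factor. -/
theorem centreBlocks_wordConv_of_prefix
    (hfree : ∀ bs, bs ≠ [] → AlternatingBlocks bs → centreBlocks m bs φ [] = 0) (i : ι)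
    (bs pre : List (ι × ℕ)) (hpre : pre ≠ []) (h : AlternatingBlocks (pre ++ bs)) :
    centreBlocks m bs (wordConv i (centreBlocks m pre φ) φ) [] = 0 := by
  induction bs generalizing pre with
  | nil => rfl
  | cons b bs ih =>
    have h' : AlternatingBlocks ((pre ++ [b]) ++ bs) := by simpa using h
    have hrec := ih (pre ++ [b]) (by simp) h'
    rw [centreBlocks_append] at hrec
    simp only [centreBlocks] at hrec ⊢
    rw [centreBlock_wordConv, centreBlocks_add]
    simp only [hrec, add_zero]
    obtain ⟨k, n⟩ := b
    by_cases hk : k = i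
    · subst hk
      have hz : ∀ a, centreBlocks m pre φ (List.replicate a k) = 0 := by
        intro a
        have h1 : AlternatingBlocks pre := h.left_of_append
        have h2 : AlternatingBlocks (pre ++ [(k, a)]) := by
          have := (List.isChain_append.1 h).2.2
          exact List.isChain_append.2 ⟨h1, List.isChain_singleton _, fun x hx y hy => by
            have := this x hx (k, n) (by simp)
            simp only [List.head?_cons, Option.mem_def, Option.some.injEq] at hy
            subst hy
            exact this⟩
        have e1 := hfree pre hpre h1
        have e2 := hfree _ (by simp) h2
        rw [centreBlocks_append] at e2
        simpa [centreBlocks, centreBlock, e1] using e2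
      simp only [wordConv_replicate_self, hz, zero_mul, Finset.sum_const_zero]
      exact centreBlocks_zero m bs []
    · simp only [wordConv_replicate_of_ne hk]
      exact centreBlocks_zero m bs []

/-- The Schwinger–Dyson equation for the joint moments. -/
theorem moment_cons_eq_wordConv (hm1 : m 1 = 0)
    (hm : ∀ n, m (n + 1) = ∑ a ∈ Finset.range n, m a * m (n - 1 - a))
    (hpow : ∀ k n, φ (List.replicate n k) = m n)
    (hfree : ∀ bs, bs ≠ [] → AlternatingBlocks bs → centreBlocks m bs φ [] = 0) (i : ι)
    (L : List ι) : φ (i :: L) = wordConv i φ φ L := by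
  rw [← sub_eq_zero]
  refine eq_zero_of_centreBlocks hm1 L (f := fun L => φ (i :: L) - wordConv i φ φ L) ?_
  have hcons : ∀ bs, AlternatingBlocks ((i, 1) :: bs) →
      centreBlocks m bs (fun W => φ (i :: W)) [] = 0 := by
    intro bs h
    have := hfree _ (by simp) h
    simpa [centreBlocks_cons, hm1] using this
  intro bs hbs
  rw [centreBlocks_sub]
  cases bs with
  | nil =>
    have := hpow i 1
    simp only [List.replicate_one] at this
    simp [centreBlocks, this, hm1]
  | cons b bs =>
    -- Splittings beyond the first block contribute nothing.
    have hA := centreBlocks_wordConv_of_prefix hfree i bs [b] (by simp) hbs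
    simp only [centreBlocks] at hA ⊢
    rw [centreBlock_wordConv, centreBlocks_add]
    simp only [hA, add_zero]
    obtain ⟨k, n⟩ := b
    by_cases hk : k = i
    · subst hk
      simp only [wordConv_replicate_self, centreBlocks_sum, centreBlocks_mul]
      unfold centreBlock
      simp only
      rw [centreBlocks_sub, centreBlocks_mul]
      cases bs with
      | nil =>
        -- With a single block the equation is the moment recursion `hm`.
        simp only [centreBlocks, List.append_nil, hpow]
        have h1 := hpow k (n + 1)
        have h2 := hpow k 1
        simp only [List.replicate_succ, List.replicate_zero] at h1 h2
        rw [h1, h2, hm1, hm]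
        ring
      | cons b' bs =>
        have hne := List.isChain_cons_cons.1 hbs
        -- A bare power in front of a non-empty centred product of other blocks still has moment
        -- zero, so every term vanishes.
        have hB : ∀ a, centreBlocks m (b' :: bs) (fun W => φ (List.replicate a k ++ W)) [] = 0 := by
          intro a
          have e1 := hfree ((k, a) :: b' :: bs) (by simp) (List.isChain_cons_cons.2 hne)
          have e2 := hfree (b' :: bs) (by simp) hne.2
          simpa [centreBlocks_cons, e2] using e1
        have h1 := hB (n + 1)
        have h2 := hB 1
        simp only [List.replicate_succ, List.replicate_zero, List.cons_append, List.nil_append]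
          at h1 h2
        simp only [hB, h1, h2]
        simp
    · have := hcons ((k, n) :: bs) (List.isChain_cons_cons.2 ⟨Ne.symm hk, hbs⟩)
      simp only [wordConv_replicate_of_ne hk]
      rw [centreBlocks] at this
      rw [this]
      rw [centreBlocks_zero, sub_zero]

end Centring

/-! ### Schwinger–Dyson equation and growth of moments for free semicirculars -/

section Moments

variable {A : Type*} [Ring A] [Algebra ℂ A] {ι : Type*} {τ : A →ₗ[ℂ] ℂ} {a : ι → A}

/-- The moments of the standard semicircle law. -/
def semicircleMoment (n : ℕ) : ℂ := if Even n then (catalan (n / 2) : ℂ) else 0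

/-- For even n every product contains an odd moment. For odd n only even k survive, which leaves the
Catalan recursion. -/
theorem semicircleMoment_succ (n : ℕ) :
    semicircleMoment (n + 1) =
      ∑ k ∈ Finset.range n, semicircleMoment k * semicircleMoment (n - 1 - k) := by
  rcases Nat.even_or_odd' n with ⟨p, rfl | rfl⟩
  · rw [Finset.sum_eq_zero]
    · simp [semicircleMoment]
    · intro k hk
      have := Finset.mem_range.1 hk
      rcases Nat.even_or_odd k with h | h
      · have : ¬Even (2 * p - 1 - k) := by
          rw [Nat.not_even_iff_odd]
          obtain ⟨q, rfl⟩ := h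
          exact ⟨p - q - 1, by omega⟩
        simp [semicircleMoment, this]
      · simp [semicircleMoment, Nat.not_even_iff_odd.2 h]
  · have hsub : (Finset.range (p + 1)).image (2 * ·) ⊆ Finset.range (2 * p + 1) := by
      intro k hk
      obtain ⟨q, hq, rfl⟩ := Finset.mem_image.1 hk
      have := Finset.mem_range.1 hq
      exact Finset.mem_range.2 (by omega)
    rw [← Finset.sum_subset hsub]
    · rw [Finset.sum_image (by intro x _ y _ h; simpa using h)]
      have h1 : 2 * p + 1 + 1 = 2 * (p + 1) := by ring
      rw [h1, semicircleMoment, if_pos (even_two_mul _), Nat.mul_div_cancel_left _ two_pos,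
        catalan_succ, ← Fin.sum_univ_eq_sum_range
          (fun k => semicircleMoment (2 * k) * semicircleMoment (2 * p + 1 - 1 - 2 * k))]
      push_cast
      refine Finset.sum_congr rfl fun k _ => ?_
      have h2 : 2 * p - 2 * (k : ℕ) = 2 * (p - k) := by omega
      rw [h2]
      simp [semicircleMoment]
    · intro k hk hk'
      have : ¬Even k := by
        rintro ⟨q, rfl⟩
        have := Finset.mem_range.1 hk
        exact hk' (Finset.mem_image.2 ⟨q, Finset.mem_range.2 (by omega), by omega⟩)
      simp [semicircleMoment, this]

theorem centreBlocks_left (m : ℕ → ℂ) (bs : List (ι × ℕ)) (x : A) (W : List ι) :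
    centreBlocks m bs (fun W => τ (x * (W.map a).prod)) W =
      τ (x * (bs.map fun b => a b.1 ^ b.2 - algebraMap ℂ A (m b.2)).prod * (W.map a).prod) := by
  induction bs generalizing x with
  | nil => simp [centreBlocks]
  | cons b bs ih =>
    have : centreBlock m b (fun W => τ (x * (W.map a).prod)) = fun W =>
        τ (x * (a b.1 ^ b.2 - algebraMap ℂ A (m b.2)) * (W.map a).prod) := by
      funext W
      simp only [centreBlock, List.map_append, List.map_replicate, List.prod_append,
        List.prod_replicate, mul_sub, sub_mul, map_sub, mul_assoc, ← Algebra.smul_def,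
        mul_smul_comm, map_smul, smul_eq_mul]
    rw [centreBlocks, this, ih]
    simp [mul_assoc]

theorem centreBlocks_right (m : ℕ → ℂ) (bs : List (ι × ℕ)) (x : A) (W : List ι) :
    centreBlocks m bs (fun W => τ ((W.reverse.map a).prod * x)) W =
      τ ((W.reverse.map a).prod *
        (bs.reverse.map fun b => a b.1 ^ b.2 - algebraMap ℂ A (m b.2)).prod * x) := by
  induction bs generalizing x with
  | nil => simp [centreBlocks]
  | cons b bs ih =>
    have : centreBlock m b (fun W => τ ((W.reverse.map a).prod * x)) = fun W =>
        τ ((W.reverse.map a).prod * ((a b.1 ^ b.2 - algebraMap ℂ A (m b.2)) * x)) := by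
      funext W
      simp only [centreBlock, List.reverse_append, List.reverse_replicate, List.map_append,
        List.map_replicate, List.prod_append,
        List.prod_replicate, mul_sub, sub_mul, map_sub, mul_assoc, ← Algebra.smul_def,
        mul_smul_comm, map_smul, smul_eq_mul]
    rw [centreBlocks, this, ih]
    simp [mul_assoc]

theorem AreFree.map_prod_centred (hτ : τ 1 = 1) (ha : ∀ i, IsStandardSemicircular τ (a i))
    (hfree : AreFree τ a) {bs : List (ι × ℕ)} (hne : bs ≠ []) (hbs : AlternatingBlocks bs) :
    τ (bs.map fun b => a b.1 ^ b.2 - algebraMap ℂ A (semicircleMoment b.2)).prod = 0 := by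
  have h := hfree (bs.map fun b => (b.1, a b.1 ^ b.2 - algebraMap ℂ A (semicircleMoment b.2)))
    (by simpa using hne) ?_ ?_
  · simpa [Function.comp_def] using h
  · rw [List.isChain_map]
    exact hbs
  · intro x hx
    obtain ⟨b, -, rfl⟩ := List.mem_map.1 hx
    refine ⟨sub_mem (pow_mem (Algebra.self_mem_adjoin_singleton ℂ _) _)
      (Subalgebra.algebraMap_mem _ _), ?_⟩
    have := ha b.1 b.2
    change τ (a b.1 ^ b.2 - _) = 0
    rw [map_sub, this, Algebra.algebraMap_eq_smul_one, map_smul, hτ]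
    simp [semicircleMoment]

variable [DecidableEq ι]

theorem jointMoment_cons (hτ : τ 1 = 1) (ha : ∀ i, IsStandardSemicircular τ (a i))
    (hfree : AreFree τ a) (i : ι) (L : List ι) :
    jointMoment τ a (i :: L) = wordConv i (jointMoment τ a) (jointMoment τ a) L := by
  refine moment_cons_eq_wordConv (m := semicircleMoment) (by simp [semicircleMoment]) semicircleMoment_succ ?_ ?_ i L
  · intro k n
    simpa [jointMoment, semicircleMoment] using ha k n
  · intro bs hne hbs
    have := centreBlocks_left (τ := τ) (a := a) semicircleMoment bs 1 []
    simp only [one_mul, List.map_nil, List.prod_nil, mul_one] at this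
    exact this.trans (hfree.map_prod_centred hτ ha hne hbs)

/-- Since τ is not assumed tracial, the equation for a last letter is obtained by running the
argument on reversed words: a reversed alternating product of centred powers is again alternating
and centred. -/
theorem jointMoment_reverse_cons (hτ : τ 1 = 1) (ha : ∀ i, IsStandardSemicircular τ (a i))
    (hfree : AreFree τ a) (i : ι) (L : List ι) :
    jointMoment τ a (i :: L).reverse = wordConv i (fun L => jointMoment τ a L.reverse)
      (fun L => jointMoment τ a L.reverse) L := by
  refine moment_cons_eq_wordConv (m := semicircleMoment) (φ := fun L => jointMoment τ a L.reverse)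
    (by simp [semicircleMoment]) semicircleMoment_succ ?_ ?_ i L
  · intro k n
    simpa [jointMoment, semicircleMoment] using ha k n
  · intro bs hne hbs
    have := centreBlocks_right (τ := τ) (a := a) semicircleMoment bs 1 []
    simp only [one_mul, List.reverse_nil, List.map_nil, List.prod_nil, mul_one] at this
    refine this.trans (hfree.map_prod_centred hτ ha (by simpa using hne) ?_)
    refine List.isChain_reverse.2 (List.IsChain.imp (fun _ _ h => h.symm) hbs)

theorem wordConv_reverse (i : ι) (c c' : List ι → ℂ) (L : List ι) :
    wordConv i (fun A => c A.reverse) (fun A => c' A.reverse) L.reverse = wordConv i c' c L := by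
  induction L generalizing c' with
  | nil => rfl
  | cons l L ih =>
    rw [List.reverse_cons, wordConv_append_singleton, wordConv_cons, ← ih]
    simp [mul_comm, add_comm]

theorem jointMoment_append_singleton (hτ : τ 1 = 1) (ha : ∀ i, IsStandardSemicircular τ (a i))
    (hfree : AreFree τ a) (i : ι) (L : List ι) :
    jointMoment τ a (L ++ [i]) = wordConv i (jointMoment τ a) (jointMoment τ a) L := by
  have := jointMoment_reverse_cons hτ ha hfree i L.reverse
  rw [wordConv_reverse] at this
  simpa using this

omit [DecidableEq ι] in
theorem jointMoment_nil (hτ : τ 1 = 1) : jointMoment τ a [] = 1 := by simpa [jointMoment] using hτ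

omit [DecidableEq ι] in
theorem catalan_le_succ (n : ℕ) : catalan n ≤ catalan (n + 1) := by
  rw [catalan_succ]
  exact (by simp : catalan n ≤ catalan ((0 : Fin n.succ) : ℕ) * catalan (n - (0 : Fin n.succ))).trans
    (Finset.single_le_sum (f := fun i : Fin n.succ => catalan i * catalan (n - i))
      (fun _ _ => Nat.zero_le _) (Finset.mem_univ 0))

omit [DecidableEq ι] in
theorem catalan_le_four_pow (n : ℕ) : catalan n ≤ 4 ^ n := by
  rw [catalan_eq_centralBinom_div]
  refine (Nat.div_le_self _ _).trans ?_
  rw [Nat.centralBinom]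
  refine (Nat.choose_le_two_pow _ _).trans_eq ?_
  rw [pow_mul]
  norm_num

/-- The Schwinger–Dyson recursion is dominated by the Catalan recursion, with the index `|L|` in
place of `|L| + 1`. -/
theorem norm_jointMoment_le (hτ : τ 1 = 1) (ha : ∀ i, IsStandardSemicircular τ (a i))
    (hfree : AreFree τ a) (L : List ι) : ‖jointMoment τ a L‖ ≤ catalan L.length := by
  induction hn : L.length using Nat.strong_induction_on generalizing L with
  | _ n ih =>
    cases L with
    | nil =>
      subst hn
      simp [jointMoment_nil hτ]
    | cons i L =>
      subst hn
      have hb : ∀ A : List ι, A.length < L.length → ‖jointMoment τ a A‖ ≤ (catalan A.length : ℝ) :=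
        fun A hA => ih _ (hA.trans (by simp)) A rfl
      rw [jointMoment_cons hτ ha hfree]
      refine (norm_wordConv_le i _ _ (fun n => (catalan n : ℝ)) (fun n => (catalan n : ℝ)) L
        hb hb).trans ?_
      rw [List.length_cons]
      refine le_trans ?_ (Nat.cast_le.2 (catalan_le_succ L.length))
      cases L.length with
      | zero => simp
      | succ p =>
        rw [catalan_succ, ← Fin.sum_univ_eq_sum_range
          (fun k => (catalan k : ℝ) * (catalan (p + 1 - 1 - k) : ℝ))]
        simp

/-- The coefficients `i^{|L|} φ(L)` of the Schwinger–Dyson kernel. -/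
noncomputable def kernelCoeff (φ : List ι → ℂ) (L : List ι) : ℂ := Complex.I ^ L.length * φ L

omit [DecidableEq ι] in
theorem kernelCoeff_nil (hτ : τ 1 = 1) : kernelCoeff (jointMoment τ a) [] = 1 := by
  simp [kernelCoeff, jointMoment_nil hτ]

/-- The sign is the square of the imaginary unit, contributed by the removed letter and the extra
letter counted in `L.length + 1`. -/
theorem wordConv_kernelCoeff (φ : List ι → ℂ) (i : ι) (L : List ι) :
    wordConv i (kernelCoeff φ) (kernelCoeff φ) L =
      -(Complex.I ^ (L.length + 1) * wordConv i φ φ L) := by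
  rw [wordConv, wordConv, Finset.mul_sum, ← Finset.sum_neg_distrib]
  refine Finset.sum_congr rfl fun p hp => ?_
  rw [← mem_wordSplits.1 hp]
  simp only [kernelCoeff, List.length_append, List.length_cons]
  have : Complex.I ^ (p.1.length + (p.2.length + 1) + 1) =
      -(Complex.I ^ p.1.length * Complex.I ^ p.2.length) := by
    rw [show p.1.length + (p.2.length + 1) + 1 = p.1.length + p.2.length + 2 by ring, pow_add,
      pow_add, Complex.I_sq]
    ring
  rw [this]
  ring

theorem kernelCoeff_cons (hτ : τ 1 = 1) (ha : ∀ i, IsStandardSemicircular τ (a i))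
    (hfree : AreFree τ a) (i : ι) (L : List ι) :
    kernelCoeff (jointMoment τ a) (i :: L) =
      -wordConv i (kernelCoeff (jointMoment τ a)) (kernelCoeff (jointMoment τ a)) L := by
  rw [wordConv_kernelCoeff, neg_neg, kernelCoeff, jointMoment_cons hτ ha hfree, List.length_cons]

theorem kernelCoeff_append_singleton (hτ : τ 1 = 1) (ha : ∀ i, IsStandardSemicircular τ (a i))
    (hfree : AreFree τ a) (i : ι) (L : List ι) :
    kernelCoeff (jointMoment τ a) (L ++ [i]) =
      -wordConv i (kernelCoeff (jointMoment τ a)) (kernelCoeff (jointMoment τ a)) L := by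
  rw [wordConv_kernelCoeff, neg_neg, kernelCoeff, jointMoment_append_singleton hτ ha hfree]
  simp

theorem expBounded_kernelCoeff (hτ : τ 1 = 1) (ha : ∀ i, IsStandardSemicircular τ (a i))
    (hfree : AreFree τ a) : ExpBounded (kernelCoeff (jointMoment τ a)) := by
  refine ⟨1, 4, by norm_num, by norm_num, fun L => ?_⟩
  rw [kernelCoeff, norm_mul, norm_pow, Complex.norm_I, one_pow]
  refine mul_le_mul le_rfl ((norm_jointMoment_le hτ ha hfree L).trans ?_) (norm_nonneg _) zero_le_one
  exact_mod_cast catalan_le_four_pow L.length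

end Moments

/-! ### Sums over non-crossing partial matchings -/

section Matchings

theorem mem_unmatchedPoints {π : Finset (Finset ℕ)} {k : ℕ} :
    k ∈ unmatchedPoints π ↔ {k} ∈ π := by
  simp only [unmatchedPoints, Finset.mem_filter, Finset.mem_biUnion, id, and_iff_right_iff_imp]
  exact fun h => ⟨{k}, h, by simp⟩

/-- The matching obtained from `π` by matching the point `n` with the largest unmatched point. -/
def matchLast (π : Finset (Finset ℕ)) (h : (unmatchedPoints π).Nonempty) (n : ℕ) :
    Finset (Finset ℕ) :=
  insert {(unmatchedPoints π).max' h, n} (π.erase {(unmatchedPoints π).max' h})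

theorem subset_range_of_mem_partialMatchingsNC {n : ℕ} {π : Finset (Finset ℕ)}
    (hπ : π ∈ partialMatchingsNC n) {B : Finset ℕ} (hB : B ∈ π) : B ⊆ Finset.range n := by
  induction n generalizing π B with
  | zero =>
    simp only [partialMatchingsNC, Finset.mem_singleton] at hπ
    simp [hπ] at hB
  | succ n ih =>
    have hmono : Finset.range n ⊆ Finset.range (n + 1) := Finset.range_mono (Nat.le_succ n)
    simp only [partialMatchingsNC, Finset.mem_union, Finset.mem_image, Finset.mem_biUnion] at hπ
    rcases hπ with ⟨σ, hσ, rfl⟩ | ⟨σ, hσ, hπ⟩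
    · rcases Finset.mem_insert.1 hB with rfl | hB
      · simp
      · exact (ih hσ hB).trans hmono
    · split_ifs at hπ with h
      · rw [Finset.mem_singleton] at hπ
        subst hπ
        rcases Finset.mem_insert.1 hB with rfl | hB
        · have := ih hσ (mem_unmatchedPoints.1 ((unmatchedPoints σ).max'_mem h))
          rw [Finset.singleton_subset_iff] at this
          rw [Finset.insert_subset_iff]
          exact ⟨hmono this, by simp⟩
        · exact (ih hσ (Finset.mem_of_mem_erase hB)).trans hmono
      · simp at hπ

theorem notMem_of_mem_partialMatchingsNC {n : ℕ} {π : Finset (Finset ℕ)}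
    (hπ : π ∈ partialMatchingsNC n) {B : Finset ℕ} (hB : n ∈ B) : B ∉ π := fun h => by
  simpa using subset_range_of_mem_partialMatchingsNC hπ h hB

theorem lt_of_mem_unmatchedPoints {n : ℕ} {π : Finset (Finset ℕ)}
    (hπ : π ∈ partialMatchingsNC n) {k : ℕ} (hk : k ∈ unmatchedPoints π) : k < n := by
  simpa using subset_range_of_mem_partialMatchingsNC hπ (mem_unmatchedPoints.1 hk)

/-- The block of the point n shows which operation was used and which point was matched, so the
parent matching can be recovered and nothing is counted twice. -/
theorem sum_partialMatchingsNC_succ {M : Type*} [AddCommMonoid M] (n : ℕ)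
    (F : Finset (Finset ℕ) → M) :
    ∑ π ∈ partialMatchingsNC (n + 1), F π =
      ∑ π ∈ partialMatchingsNC n, (F (insert {n} π) +
        if h : (unmatchedPoints π).Nonempty then F (matchLast π h n) else 0) := by
  rw [partialMatchingsNC, Finset.sum_union, Finset.sum_image, Finset.sum_biUnion,
    Finset.sum_add_distrib]
  · congr 1
    refine Finset.sum_congr rfl fun π _ => ?_
    split_ifs <;> simp [matchLast]
  · intro π hπ σ hσ hne
    rw [Function.onFun, Finset.disjoint_left]
    intro ρ h1 h2
    apply hne
    split_ifs at h1 h2 with hp hs <;> try simp at h1 h2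
    rw [h1] at h2
    have hn1 : {(unmatchedPoints π).max' hp, n} ∉ π.erase {(unmatchedPoints π).max' hp} :=
      fun h => notMem_of_mem_partialMatchingsNC hπ (by simp) (Finset.mem_of_mem_erase h)
    have hn2 : {(unmatchedPoints σ).max' hs, n} ∉ σ.erase {(unmatchedPoints σ).max' hs} :=
      fun h => notMem_of_mem_partialMatchingsNC hσ (by simp) (Finset.mem_of_mem_erase h)
    have hm1 := (unmatchedPoints π).max'_mem hp
    have hm2 := (unmatchedPoints σ).max'_mem hs
    have hl1 := lt_of_mem_unmatchedPoints hπ hm1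
    generalize (unmatchedPoints π).max' hp = p at *
    generalize (unmatchedPoints σ).max' hs = q at *
    have hpq : ({p, n} : Finset ℕ) = {q, n} := by
      have : ({p, n} : Finset ℕ) ∈ insert {q, n} (σ.erase {q}) := by
        rw [← h2]
        exact Finset.mem_insert_self _ _
      rcases Finset.mem_insert.1 this with h | h
      · exact h
      · exact absurd (Finset.mem_of_mem_erase h)
          (notMem_of_mem_partialMatchingsNC hσ (by simp))
    have hp' : p = q := by
      have : p ∈ ({q, n} : Finset ℕ) := by rw [← hpq]; simp
      simp only [Finset.mem_insert, Finset.mem_singleton] at this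
      omega
    subst hp'
    have := congrArg (fun ρ => ρ.erase {p, n}) h2
    simp only [Finset.erase_insert hn1, Finset.erase_insert hn2] at this
    rw [← Finset.insert_erase (mem_unmatchedPoints.1 hm1), this,
      Finset.insert_erase (mem_unmatchedPoints.1 hm2)]
  · intro π hπ σ hσ h
    have h1 := notMem_of_mem_partialMatchingsNC hπ (Finset.mem_singleton_self n)
    have h2 := notMem_of_mem_partialMatchingsNC hσ (Finset.mem_singleton_self n)
    rw [← Finset.erase_insert h1, ← Finset.erase_insert h2]
    exact congrArg (fun ρ => ρ.erase {n}) h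
  · rw [Finset.disjoint_left]
    intro ρ h1 h2
    obtain ⟨π, hπ, rfl⟩ := Finset.mem_image.1 h1
    obtain ⟨σ, hσ, h2⟩ := Finset.mem_biUnion.1 h2
    split_ifs at h2 with h
    · rw [Finset.mem_singleton] at h2
      have : ({n} : Finset ℕ) ∈ insert {(unmatchedPoints σ).max' h, n}
          (σ.erase {(unmatchedPoints σ).max' h}) := by
        rw [← h2]
        exact Finset.mem_insert_self _ _
      rcases Finset.mem_insert.1 this with h3 | h3
      · have h4 : (unmatchedPoints σ).max' h ∈ ({n} : Finset ℕ) := by rw [h3]; simp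
        have := lt_of_mem_unmatchedPoints hσ ((unmatchedPoints σ).max'_mem h)
        rw [Finset.mem_singleton] at h4
        omega
      · exact notMem_of_mem_partialMatchingsNC hσ (by simp) (Finset.mem_of_mem_erase h3)
    · simp at h2

variable {d n : ℕ} {π : Finset (Finset ℕ)}

theorem unmatchedPoints_insert_singleton (π : Finset (Finset ℕ)) (n : ℕ) :
    unmatchedPoints (insert {n} π) = insert n (unmatchedPoints π) := by
  ext k
  simp [mem_unmatchedPoints]

theorem unmatchedPoints_matchLast (hπ : π ∈ partialMatchingsNC n)
    (h : (unmatchedPoints π).Nonempty) :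
    unmatchedPoints (matchLast π h n) =
      (unmatchedPoints π).erase ((unmatchedPoints π).max' h) := by
  have hlt := lt_of_mem_unmatchedPoints hπ ((unmatchedPoints π).max'_mem h)
  ext k
  have : ({k} : Finset ℕ) ≠ {(unmatchedPoints π).max' h, n} := by
    intro hk
    have h1 : (unmatchedPoints π).max' h ∈ ({k} : Finset ℕ) := by rw [hk]; simp
    have h2 : n ∈ ({k} : Finset ℕ) := by rw [hk]; simp
    rw [Finset.mem_singleton] at h1 h2
    omega
  simp [mem_unmatchedPoints, matchLast, this]

theorem sort_insert_of_lt {s : Finset ℕ} {n : ℕ} (h : ∀ k ∈ s, k < n) :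
    (insert n s).sort (· ≤ ·) = s.sort (· ≤ ·) ++ [n] := by
  have hn : n ∉ s := fun hn => (h n hn).false
  refine List.Perm.eq_of_pairwise (le := (· ≤ ·)) (fun _ _ _ _ => le_antisymm)
    (Finset.pairwise_sort _ _) ?_ ?_
  · rw [List.pairwise_append]
    refine ⟨Finset.pairwise_sort _ _, List.pairwise_singleton _ _, fun a ha b hb => ?_⟩
    rw [List.mem_singleton] at hb
    subst hb
    exact (h a ((Finset.mem_sort _).1 ha)).le
  · refine (List.perm_ext_iff_of_nodup (Finset.sort_nodup _ _) ?_).2 fun a => ?_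
    · refine List.Nodup.append (Finset.sort_nodup _ _) (List.nodup_singleton _) ?_
      simpa using hn
    · simp [or_comm]

theorem filterMap_getElem?_append {I : List (Fin d)} (J : List (Fin d)) {l : List ℕ}
    (h : ∀ k ∈ l, k < I.length) :
    l.filterMap (fun k => (I ++ J)[k]?) = l.filterMap fun k => I[k]? :=
  List.filterMap_congr fun k hk => List.getElem?_append_left (h k hk)

theorem unmatchedWord_insert_singleton {I : List (Fin d)} (i : Fin d)
    (hπ : π ∈ partialMatchingsNC I.length) :
    unmatchedWord (I ++ [i]) (insert {I.length} π) = unmatchedWord I π ++ [i] := by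
  have hlt : ∀ k ∈ unmatchedPoints π, k < I.length := fun k => lt_of_mem_unmatchedPoints hπ
  rw [unmatchedWord, unmatchedPoints_insert_singleton, sort_insert_of_lt hlt, List.filterMap_append,
    filterMap_getElem?_append _ (by simpa using hlt)]
  simp [unmatchedWord]

theorem unmatchedWord_eq_append {I : List (Fin d)} (hπ : π ∈ partialMatchingsNC I.length)
    (h : (unmatchedPoints π).Nonempty) (i : Fin d) :
    ∃ x, I[(unmatchedPoints π).max' h]? = some x ∧
      unmatchedWord I π = unmatchedWord (I ++ [i]) (matchLast π h I.length) ++ [x] := by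
  have hlt : ∀ k ∈ unmatchedPoints π, k < I.length := fun k => lt_of_mem_unmatchedPoints hπ
  have hm := (unmatchedPoints π).max'_mem h
  refine ⟨I[(unmatchedPoints π).max' h]'(hlt _ hm), List.getElem?_eq_getElem _, ?_⟩
  have hs : (unmatchedPoints π).sort (· ≤ ·) =
      ((unmatchedPoints π).erase ((unmatchedPoints π).max' h)).sort (· ≤ ·) ++
        [(unmatchedPoints π).max' h] := by
    rw [← sort_insert_of_lt, Finset.insert_erase hm]
    intro k hk
    exact lt_of_le_of_ne (Finset.le_max' _ _ (Finset.mem_of_mem_erase hk)) (Finset.ne_of_mem_erase hk)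
  rw [unmatchedWord, hs, List.filterMap_append, unmatchedWord, unmatchedPoints_matchLast hπ,
    filterMap_getElem?_append]
  · simp [List.getElem?_eq_getElem (hlt _ hm)]
  · intro k hk
    exact hlt k (Finset.mem_of_mem_erase ((Finset.mem_sort _).1 hk))

theorem matchingWeight_factor_congr {I : List (Fin d)} (i : Fin d) {B : Finset ℕ}
    (hB : B ⊆ Finset.range I.length) :
    (if ∀ p ∈ B, ∀ q ∈ B, (I ++ [i])[p]? = (I ++ [i])[q]? then (-1 : ℂ) else 0) =
      if ∀ p ∈ B, ∀ q ∈ B, I[p]? = I[q]? then -1 else 0 := by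
  refine if_congr (forall₂_congr fun p hp => forall₂_congr fun q hq => ?_) rfl rfl
  rw [List.getElem?_append_left (Finset.mem_range.1 (hB hp)),
    List.getElem?_append_left (Finset.mem_range.1 (hB hq))]

theorem matchingWeight_insert_singleton {I : List (Fin d)} (i : Fin d)
    (hπ : π ∈ partialMatchingsNC I.length) :
    matchingWeight (I ++ [i]) (insert {I.length} π) = matchingWeight I π := by
  have : matchedPairs (insert {I.length} π) = matchedPairs π := by
    simp [matchedPairs, Finset.filter_insert]
  rw [matchingWeight, this, matchingWeight]
  exact Finset.prod_congr rfl fun B hB => matchingWeight_factor_congr i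
    (subset_range_of_mem_partialMatchingsNC hπ (Finset.mem_filter.1 hB).1)

theorem matchingWeight_matchLast {I : List (Fin d)} (i : Fin d)
    (hπ : π ∈ partialMatchingsNC I.length) (h : (unmatchedPoints π).Nonempty) :
    matchingWeight (I ++ [i]) (matchLast π h I.length) =
      (if (unmatchedWord I π).getLast? = some i then -1 else 0) * matchingWeight I π := by
  have hm := (unmatchedPoints π).max'_mem h
  have hlt := lt_of_mem_unmatchedPoints hπ hm
  have hp : matchedPairs (matchLast π h I.length) =
      insert {(unmatchedPoints π).max' h, I.length} (matchedPairs π) := by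
    rw [matchedPairs, matchLast, Finset.filter_insert, if_pos (Finset.card_pair hlt.ne),
      Finset.filter_erase, Finset.erase_eq_of_notMem (by simp)]
    rfl
  obtain ⟨x, hx, hw⟩ := unmatchedWord_eq_append hπ h i
  rw [matchingWeight, hp, Finset.prod_insert]
  · congr 1
    · rw [hw]
      refine if_congr ?_ rfl rfl
      simp only [Finset.mem_insert, Finset.mem_singleton, forall_eq_or_imp, forall_eq,
        List.getElem?_append_left hlt, hx, List.getLast?_append, List.getLast?_singleton]
      simp [eq_comm]
    · exact Finset.prod_congr rfl fun B hB => matchingWeight_factor_congr i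
        (subset_range_of_mem_partialMatchingsNC hπ (Finset.mem_filter.1 hB).1)
  · intro hB
    exact notMem_of_mem_partialMatchingsNC hπ (by simp) (Finset.mem_filter.1 hB).1

theorem unmatchedPoints_nonempty_iff {I : List (Fin d)} (hπ : π ∈ partialMatchingsNC I.length) :
    (unmatchedPoints π).Nonempty ↔ unmatchedWord I π ≠ [] := by
  constructor
  · intro h hw
    -- A non-empty I supplies a letter to which `unmatchedWord_eq_append` can be applied; an empty I
    -- has no points.
    cases I with
    | nil =>
      obtain ⟨k, hk⟩ := h
      simpa using lt_of_mem_unmatchedPoints hπ hk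
    | cons i I =>
      obtain ⟨x, -, h'⟩ := unmatchedWord_eq_append hπ h i
      simp [h'] at hw
  · intro h
    by_contra h'
    rw [Finset.not_nonempty_iff_eq_empty] at h'
    exact h (by simp [unmatchedWord, h'])

/-- The recursion for sums over non-crossing partial matchings of a function of the unmatched
word. -/
theorem sum_matchingWeight_append_singleton (I : List (Fin d)) (i : Fin d)
    (G : List (Fin d) → ℂ) :
    ∑ π ∈ partialMatchingsNC (I ++ [i]).length,
        matchingWeight (I ++ [i]) π * G (unmatchedWord (I ++ [i]) π) =
      ∑ π ∈ partialMatchingsNC I.length, matchingWeight I π *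
        (G (unmatchedWord I π ++ [i]) -
          if (unmatchedWord I π).getLast? = some i then G (unmatchedWord I π).dropLast else 0) := by
  rw [List.length_append, List.length_singleton, sum_partialMatchingsNC_succ]
  refine Finset.sum_congr rfl fun π hπ => ?_
  rw [matchingWeight_insert_singleton i hπ, unmatchedWord_insert_singleton i hπ]
  by_cases h : (unmatchedPoints π).Nonempty
  · rw [dif_pos h, matchingWeight_matchLast i hπ h]
    obtain ⟨x, -, hw⟩ := unmatchedWord_eq_append hπ h i
    have : unmatchedWord (I ++ [i]) (matchLast π h I.length) = (unmatchedWord I π).dropLast := by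
      rw [hw, List.dropLast_concat]
    rw [this]
    split_ifs <;> ring
  · rw [dif_neg h]
    have := (unmatchedPoints_nonempty_iff hπ).not.1 h
    rw [not_not] at this
    simp [this]

theorem sum_matchingWeight_nil (G : List (Fin d) → ℂ) :
    ∑ π ∈ partialMatchingsNC ([] : List (Fin d)).length,
      matchingWeight ([] : List (Fin d)) π * G (unmatchedWord [] π) = G [] := by
  simp [partialMatchingsNC, matchingWeight, matchedPairs, unmatchedWord]

variable {k : List (Fin d) → ℂ}

/-- The reversal appears because `auxCoeff_cons` acts at the head of the index word, while the
unmatched word changes at its end. -/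
theorem coeff_append_eq_sum (hk : k [] = 1) (hl : ∀ i L, k (i :: L) = -wordConv i k k L)
    (I L : List (Fin d)) :
    k (I ++ L) = ∑ π ∈ partialMatchingsNC I.length,
      matchingWeight I π * auxCoeff k (unmatchedWord I π).reverse L := by
  induction I using List.reverseRecOn generalizing L with
  | nil => rw [sum_matchingWeight_nil fun J => auxCoeff k J.reverse L]; rfl
  | append_singleton I i ih =>
    rw [sum_matchingWeight_append_singleton I i fun J => auxCoeff k J.reverse L, List.append_assoc,
      List.singleton_append, ih]
    refine Finset.sum_congr rfl fun π _ => ?_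
    rw [auxCoeff_cons hk hl]
    simp

theorem coeff_reverse_append_eq_sum (hk : k [] = 1)
    (hl : ∀ i L, k (i :: L) = -wordConv i k k L)
    (hr : ∀ i L, k (L ++ [i]) = -wordConv i k k L) (I L : List (Fin d)) :
    k (I.reverse ++ L) = ∑ π ∈ partialMatchingsNC I.length,
      matchingWeight I π * auxCoeff k (unmatchedWord I π) L := by
  induction I using List.reverseRecOn generalizing L with
  | nil => rw [sum_matchingWeight_nil fun J => auxCoeff k J L]; rfl
  | append_singleton I i ih =>
    rw [sum_matchingWeight_append_singleton I i fun J => auxCoeff k J L]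
    -- `hl` and `hr` have the same right-hand side, so a letter can be rotated from the front to the
    -- end.
    have : k ((I ++ [i]).reverse ++ L) = k (I.reverse ++ (L ++ [i])) := by
      rw [List.reverse_append, List.reverse_singleton, List.singleton_append, List.cons_append, hl,
        ← hr, List.append_assoc]
    rw [this, ih]
    refine Finset.sum_congr rfl fun π _ => ?_
    rw [auxCoeff_append_singleton hk hr]

end Matchings

/-! ### Integrals with respect to signed measures -/

section Signed

variable {α : Type*} [MeasurableSpace α]

theorem isFiniteMeasure_variation (μ : SignedMeasure α) : IsFiniteMeasure μ.variation := by
  rw [← SignedMeasure.totalVariation_eq_variation, SignedMeasure.totalVariation]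
  infer_instance

open Classical in
/-- The density, with values `±1`, of a signed measure with respect to its variation. -/
noncomputable def signDensity (μ : SignedMeasure α) : α → ℝ :=
  fun x => if x ∈ μ.toJordanDecomposition.mutuallySingular.nullSet then -1 else 1

theorem measurable_signDensity (μ : SignedMeasure α) : Measurable (signDensity μ) :=
  Measurable.ite μ.toJordanDecomposition.mutuallySingular.measurableSet_nullSet
    measurable_const measurable_const

theorem abs_signDensity (μ : SignedMeasure α) (x : α) : |signDensity μ x| = 1 := by
  unfold signDensity
  split_ifs <;> simp

variable {E : Type*} [NormedAddCommGroup E] [NormedSpace ℝ E]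

theorem integrable_signDensity_smul (μ : SignedMeasure α) {f : α → E} {ρ : Measure α} :
    Integrable (fun x => signDensity μ x • f x) ρ ↔ Integrable f ρ := by
  have hs : ∀ x, signDensity μ x * signDensity μ x = 1 := fun x => by
    rw [← abs_mul_abs_self, abs_signDensity, one_mul]
  have key : ∀ g : α → E, Integrable g ρ → Integrable (fun x => signDensity μ x • g x) ρ := by
    intro g hg
    refine hg.mono ((measurable_signDensity μ).aestronglyMeasurable.smul hg.1) (.of_forall fun x => ?_)
    rw [norm_smul, Real.norm_eq_abs, abs_signDensity, one_mul]
  refine ⟨fun h => ?_, key f⟩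
  simpa [smul_smul, hs] using key _ h

/-- By the Jordan decomposition, integrals against μ become Bochner integrals against a finite
positive measure, to which Fubini and dominated convergence apply. -/
theorem integral_signedMeasure_eq (μ : SignedMeasure α) (f : α → E) :
    ∫ᵛ x, f x ∂<•μ = ∫ x, signDensity μ x • f x ∂μ.variation := by
  by_cases hf : Integrable f μ.variation
  swap
  -- Without integrability both sides take the default value 0.
  · rw [VectorMeasure.integral_undef hf,
      integral_undef fun h => hf ((integrable_signDensity_smul μ).1 h)]
  have hv := SignedMeasure.totalVariation_eq_variation μ
  rw [SignedMeasure.totalVariation] at hv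
  have hms := μ.toJordanDecomposition.mutuallySingular
  have hg := (integrable_signDensity_smul μ).2 hf
  rw [← hv] at hf hg
  have hp := hf.left_of_add_measure
  have hn := hf.right_of_add_measure
  rw [← hv, integral_add_measure hg.left_of_add_measure hg.right_of_add_measure]
  have h1 : ∫ x, signDensity μ x • f x ∂μ.toJordanDecomposition.posPart =
      ∫ x, f x ∂μ.toJordanDecomposition.posPart := by
    refine integral_congr_ae ?_
    have : ∀ᵐ x ∂μ.toJordanDecomposition.posPart, x ∉ hms.nullSet :=
      measure_eq_zero_iff_ae_notMem.1 hms.measure_nullSet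
    filter_upwards [this] with x hx
    rw [signDensity, if_neg hx, one_smul]
  have h2 : ∫ x, signDensity μ x • f x ∂μ.toJordanDecomposition.negPart =
      -∫ x, f x ∂μ.toJordanDecomposition.negPart := by
    rw [← integral_neg]
    refine integral_congr_ae ?_
    have : ∀ᵐ x ∂μ.toJordanDecomposition.negPart, x ∉ hms.nullSetᶜ :=
      measure_eq_zero_iff_ae_notMem.1 hms.measure_compl_nullSet
    filter_upwards [this] with x hx
    rw [signDensity, if_pos (not_not.1 hx), neg_one_smul]
  rw [h1, h2, ← sub_eq_add_neg]
  conv_lhs => rw [← SignedMeasure.toSignedMeasure_toJordanDecomposition μ]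
  rw [JordanDecomposition.toSignedMeasure, VectorMeasure.integral_sub_vectorMeasure,
    VectorMeasure.integral_toSignedMeasure, VectorMeasure.integral_toSignedMeasure]
  · simpa [VectorMeasure.Integrable, Measure.variation_toSignedMeasure] using hp
  · simpa [VectorMeasure.Integrable, Measure.variation_toSignedMeasure] using hn

theorem setIntegral_signedMeasure_eq (μ : SignedMeasure α) (f : α → E) {s : Set α}
    (hs : MeasurableSet s) :
    ∫ᵛ x in s, f x ∂<•μ = ∫ x in s, signDensity μ x • f x ∂μ.variation := by
  rw [← VectorMeasure.integral_indicator hs, integral_signedMeasure_eq, ← integral_indicator hs]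
  congr 1
  funext x
  by_cases hx : x ∈ s <;> simp [hx]

theorem variation_singleton_eq_zero [MeasurableSingletonClass α] (μ : SignedMeasure α) {x : α}
    (h : μ {x} = 0) : μ.variation {x} = 0 := by
  rw [← SignedMeasure.totalVariation_eq_variation]
  have hsub : ∀ s ⊆ ({x} : Set α), μ s = 0 := by
    intro s hs
    rcases subset_singleton_iff_eq.1 hs with rfl | rfl
    · simp
    · exact h
  obtain ⟨i, hi, hi0, hi1, hpos, hneg⟩ := μ.toJordanDecomposition_spec
  rw [SignedMeasure.totalVariation, Measure.add_apply, hpos, hneg,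
    SignedMeasure.toMeasureOfZeroLE_apply _ _ hi (measurableSet_singleton x),
    SignedMeasure.toMeasureOfLEZero_apply _ _ hi.compl (measurableSet_singleton x)]
  simp [hsub]

end Signed

/-! ### The coordinate measures have no atoms -/

section Coord

variable {d : ℕ} {T : ℝ} {X : ℝ → EuclideanSpace ℝ (Fin d)}

instance isFiniteMeasure_variation_coordMeasure (j : Fin d) :
    IsFiniteMeasure (coordMeasure T X j).variation := isFiniteMeasure_variation _

theorem nullSingletonClass_variation_coordMeasure (hT : 0 ≤ T) (hXc : ContinuousOn X (Icc 0 T))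
    (j : Fin d) : NullSingletonClass (coordMeasure T X j).variation := by
  refine ⟨fun x => variation_singleton_eq_zero _ ?_⟩
  have hc : Continuous fun u : ℝ => X (max 0 (min u T)) j := by
    have h1 : Continuous fun u : ℝ => X (max 0 (min u T)) :=
      hXc.comp_continuous (by fun_prop) fun u => ⟨le_max_left _ _, max_le hT (min_le_right _ _)⟩
    exact (EuclideanSpace.proj j).continuous.comp h1
  rw [coordMeasure, stieltjesMeasure]
  split_ifs with h
  -- The mass of a point is the jump there, which is zero by continuity.
  · rw [BoundedVariationOn.vectorMeasure_singleton,
      hc.continuousAt.continuousWithinAt.rightLim_eq, hc.continuousAt.continuousWithinAt.leftLim_eq,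
      sub_self]
  · simp

end Coord

/-! ### Integrals of powers of tail masses -/

section LayerCake

variable (N : Measure ℝ) [IsFiniteMeasure N]

theorem measurable_real_Ioc_left (t : ℝ) : Measurable fun u => N.real (Ioc u t) :=
  Antitone.measurable fun _ _ h => measureReal_mono (Ioc_subset_Ioc_left h)

/-- If the set has a largest point k, it lies in (s,k], whose mass is N(s,t] - N(k,t] < N(s,t] - x.
A largest point need not exist, hence the passage to compact subsets by inner regularity. -/
theorem restrict_lt_real_Ioc_le (s t x : ℝ) :
    N.restrict (Ioc s t) {u | x < N.real (Ioc u t)} ≤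
      ENNReal.ofReal (N.real (Ioc s t) - x) := by
  have hm : MeasurableSet {u | x < N.real (Ioc u t)} :=
    measurableSet_lt measurable_const (measurable_real_Ioc_left N t)
  rw [Measure.restrict_apply hm, (hm.inter measurableSet_Ioc).measure_eq_iSup_isCompact]
  refine iSup₂_le fun K hK => iSup_le fun hKc => ?_
  rcases K.eq_empty_or_nonempty with rfl | hne
  · simp
  obtain ⟨k, hk, hmax⟩ := hKc.exists_isGreatest hne
  have hk' := hK hk
  have hsub : K ⊆ Ioc s k := fun u hu => ⟨(hK hu).2.1, hmax hu⟩
  refine (measure_mono hsub).trans ?_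
  rw [← ofReal_measureReal]
  refine ENNReal.ofReal_le_ofReal ?_
  have hun : Ioc s k ∪ Ioc k t = Ioc s t := Ioc_union_Ioc_eq_Ioc hk'.2.1.le hk'.2.2
  have hd : Disjoint (Ioc s k) (Ioc k t) := by
    rw [Set.disjoint_left]
    exact fun u hu hu' => absurd hu.2 (not_le.2 hu'.1)
  have := measureReal_union (μ := N) hd measurableSet_Ioc
  rw [hun] at this
  have h1 : x < N.real (Ioc k t) := hk'.1
  linarith

theorem integral_layer_polynomial (m : ℕ) (H : ℝ) :
    ∫ x in (0 : ℝ)..H, (H - x) * ((m + 1) * x ^ m) = H ^ (m + 2) / (m + 2) := by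
  have : (fun x : ℝ => (H - x) * ((m + 1) * x ^ m)) =
      fun x => (H * (m + 1)) * x ^ m - (m + 1) * x ^ (m + 1) := by
    funext x
    ring
  rw [this, intervalIntegral.integral_sub (by apply Continuous.intervalIntegrable; fun_prop)
    (by apply Continuous.intervalIntegrable; fun_prop), intervalIntegral.integral_const_mul,
    intervalIntegral.integral_const_mul, integral_pow, integral_pow]
  push_cast
  have h1 : (m : ℝ) + 1 ≠ 0 := by positivity
  have h2 : (m : ℝ) + 2 ≠ 0 := by positivity
  have h3 : (m : ℝ) + 1 + 1 ≠ 0 := by positivity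
  field_simp
  ring

/-- This is the source of the factorials. The layer-cake formula reduces it to the distribution
bound `restrict_lt_real_Ioc_le`; atoms are allowed. -/
theorem integral_real_Ioc_pow_le (s t : ℝ) (m : ℕ) :
    ∫ u in Ioc s t, N.real (Ioc u t) ^ m ∂N ≤ N.real (Ioc s t) ^ (m + 1) / (m + 1) := by
  cases m with
  | zero => simp
  | succ m =>
    set H := N.real (Ioc s t) with hH
    have hH0 : 0 ≤ H := measureReal_nonneg
    have hmeas := measurable_real_Ioc_left N t
    have hpow : ∀ f : ℝ, ∫ x in (0 : ℝ)..f, ((m + 1) * x ^ m : ℝ) = f ^ (m + 1) := by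
      intro f
      rw [intervalIntegral.integral_const_mul, integral_pow]
      have h1 : (m : ℝ) + 1 ≠ 0 := by positivity
      field_simp
      simp
    have hlc := lintegral_comp_eq_lintegral_meas_lt_mul (N.restrict (Ioc s t))
      (f := fun u => N.real (Ioc u t)) (g := fun x => (m + 1) * x ^ m)
      (.of_forall fun _ => measureReal_nonneg) hmeas.aemeasurable
      (fun _ _ => by apply Continuous.intervalIntegrable; fun_prop)
      ((ae_restrict_iff' measurableSet_Ioi).2 (.of_forall fun x hx => by
        have : 0 < x := hx
        positivity))
    simp only [hpow] at hlc
    rw [integral_eq_lintegral_of_nonneg_ae (.of_forall fun _ => by positivity)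
      (hmeas.pow_const _).aestronglyMeasurable, hlc]
    refine ENNReal.toReal_le_of_le_ofReal (by positivity) ?_
    have hcast : H ^ (m + 1 + 1) / ((m + 1 : ℕ) + 1 : ℝ) =
        ∫ x in Ioc 0 H, (H - x) * ((m + 1) * x ^ m) := by
      rw [← intervalIntegral.integral_of_le hH0, integral_layer_polynomial]
      push_cast
      ring
    rw [hcast, ofReal_integral_eq_lintegral_ofReal]
    · rw [← lintegral_indicator measurableSet_Ioi, ← lintegral_indicator measurableSet_Ioc]
      refine lintegral_mono fun x => ?_
      by_cases hx : x ∈ Ioi (0 : ℝ)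
      · rw [indicator_of_mem hx]
        have hx' : 0 < x := hx
        have h1 := restrict_lt_real_Ioc_le N s t x
        rw [← hH] at h1
        by_cases hxH : x ≤ H
        · rw [indicator_of_mem (show x ∈ Ioc 0 H from ⟨hx', hxH⟩),
            ENNReal.ofReal_mul (sub_nonneg.2 hxH)]
          gcongr
        · rw [ENNReal.ofReal_of_nonpos (by linarith)] at h1
          simp [le_antisymm h1 bot_le]
      · simp [indicator_of_notMem hx]
    · exact (Continuous.integrableOn_Icc (by fun_prop)).mono_set Ioc_subset_Icc_self
    · refine (ae_restrict_iff' measurableSet_Ioc).2 (.of_forall fun x hx => ?_)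
      have h1 := hx.1
      have h2 := sub_nonneg.2 hx.2
      change 0 ≤ (H - x) * ((m + 1) * x ^ m)
      positivity

end LayerCake

/-! ### Iterated integrals -/

section Signature

variable {d : ℕ} {T : ℝ} {X : ℝ → EuclideanSpace ℝ (Fin d)}

theorem signatureCoord_cons (l : Fin d) (L : List (Fin d)) (s t : ℝ) :
    signatureCoord T X (l :: L) s t =
      ∫ u in Ioc s t, signDensity (coordMeasure T X l) u * signatureCoord T X L u t
        ∂(coordMeasure T X l).variation :=
  setIntegral_signedMeasure_eq _ _ measurableSet_Ioc

theorem measurableSet_setOf_mem_Ioc :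
    MeasurableSet {p : (ℝ × ℝ) × ℝ | p.2 ∈ Ioc p.1.1 p.1.2} :=
  (measurableSet_lt (measurable_fst.comp measurable_fst) measurable_snd).inter
    (measurableSet_le measurable_snd (measurable_snd.comp measurable_fst))

theorem stronglyMeasurable_signatureCoord (L : List (Fin d)) :
    StronglyMeasurable fun p : ℝ × ℝ => signatureCoord T X L p.1 p.2 := by
  induction L with
  | nil => exact stronglyMeasurable_const
  | cons l L ih =>
    simp only [signatureCoord_cons, ← integral_indicator measurableSet_Ioc]
    refine StronglyMeasurable.integral_prod_right (f := fun (p : ℝ × ℝ) u =>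
      (Ioc p.1 p.2).indicator (fun u => signDensity (coordMeasure T X l) u *
        signatureCoord T X L u p.2) u) ?_
    have h : StronglyMeasurable fun q : (ℝ × ℝ) × ℝ =>
        signDensity (coordMeasure T X l) q.2 * signatureCoord T X L q.2 q.1.2 :=
      ((measurable_signDensity _).comp measurable_snd).stronglyMeasurable.mul
        (ih.comp_measurable (by fun_prop : Measurable fun q : (ℝ × ℝ) × ℝ => (q.2, q.1.2)))
    exact h.indicator measurableSet_setOf_mem_Ioc

theorem measurable_signatureCoord_left (L : List (Fin d)) (t : ℝ) :
    Measurable fun u => signatureCoord T X L u t :=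
  (stronglyMeasurable_signatureCoord L).measurable.comp (by fun_prop : Measurable fun u => (u, t))

theorem measurable_signatureCoord_right (L : List (Fin d)) (s : ℝ) :
    Measurable fun u => signatureCoord T X L s u :=
  (stronglyMeasurable_signatureCoord L).measurable.comp (by fun_prop : Measurable fun u => (s, u))

variable (T X) in
/-- The sum of the variations of the coordinate measures. -/
noncomputable def sumVariation : Measure ℝ := ∑ j, (coordMeasure T X j).variation

instance : IsFiniteMeasure (sumVariation T X) := by
  unfold sumVariation
  infer_instance

theorem variation_coordMeasure_le (j : Fin d) :
    (coordMeasure T X j).variation ≤ sumVariation T X :=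
  Finset.single_le_sum (f := fun j => (coordMeasure T X j).variation) (fun _ _ => Measure.zero_le _)
    (Finset.mem_univ j)

/-- Dominating all coordinates by one measure lets every letter use the same tail mass in the
induction. -/
theorem abs_signatureCoord_le_pow_real_Ioc (L : List (Fin d)) (s t : ℝ) :
    |signatureCoord T X L s t| ≤ (sumVariation T X).real (Ioc s t) ^ L.length /
      (L.length.factorial : ℝ) := by
  induction L generalizing s with
  | nil => simp [signatureCoord]
  | cons l L ih =>
    have hint : Integrable (fun u => (sumVariation T X).real (Ioc u t) ^ L.length /
        (L.length.factorial : ℝ)) ((sumVariation T X).restrict (Ioc s t)) := by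
      refine Integrable.of_bound (C := (sumVariation T X).real univ ^ L.length /
        (L.length.factorial : ℝ)) (((measurable_real_Ioc_left _ t).pow_const
          _).div_const _).aestronglyMeasurable (.of_forall fun u => ?_)
      rw [Real.norm_of_nonneg (by positivity)]
      gcongr
      · simp
      · simp
    have hle : (coordMeasure T X l).variation.restrict (Ioc s t) ≤
        (sumVariation T X).restrict (Ioc s t) :=
      Measure.restrict_mono le_rfl (variation_coordMeasure_le l)
    rw [signatureCoord_cons, ← Real.norm_eq_abs]
    calc _ ≤ ∫ u in Ioc s t, (sumVariation T X).real (Ioc u t) ^ L.length /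
          (L.length.factorial : ℝ) ∂(coordMeasure T X l).variation := by
          refine norm_integral_le_of_norm_le (hint.mono_measure hle) (.of_forall fun u => ?_)
          rw [norm_mul, Real.norm_eq_abs, abs_signDensity, one_mul, Real.norm_eq_abs]
          exact ih u
      _ ≤ ∫ u in Ioc s t, (sumVariation T X).real (Ioc u t) ^ L.length /
          (L.length.factorial : ℝ) ∂(sumVariation T X) :=
          integral_mono_measure hle (.of_forall fun u => by positivity) hint
      _ ≤ _ := by
          rw [integral_div, List.length_cons, Nat.factorial_succ]
          have := integral_real_Ioc_pow_le (sumVariation T X) s t L.length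
          calc _ ≤ (sumVariation T X).real (Ioc s t) ^ (L.length + 1) / (L.length + 1) /
                (L.length.factorial : ℝ) := by gcongr
            _ = _ := by push_cast; rw [div_div]

theorem abs_signatureCoord_le (L : List (Fin d)) (s t : ℝ) :
    |signatureCoord T X L s t| ≤ (sumVariation T X).real univ ^ L.length /
      (L.length.factorial : ℝ) := by
  refine (abs_signatureCoord_le_pow_real_Ioc L s t).trans ?_
  gcongr
  · simp
  · simp

/-- The iterated integral over a word `A j B`, split at the variable of the letter `j`. -/
theorem signatureCoord_append_cons
    (hν : ∀ j : Fin d, NullSingletonClass (coordMeasure T X j).variation)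
    (A : List (Fin d)) (j : Fin d) (B : List (Fin d)) (s t : ℝ) :
    signatureCoord T X (A ++ j :: B) s t =
      ∫ u in Ioc s t, signDensity (coordMeasure T X j) u *
        (signatureCoord T X A s u * signatureCoord T X B u t) ∂(coordMeasure T X j).variation := by
  induction A generalizing s with
  | nil =>
    rw [List.nil_append, signatureCoord_cons]
    simp [signatureCoord]
  | cons l A ih =>
    rw [List.cons_append, signatureCoord_cons]
    set νl := (coordMeasure T X l).variation
    set νj := (coordMeasure T X j).variation
    set gl := signDensity (coordMeasure T X l)
    set gj := signDensity (coordMeasure T X j)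
    -- The two sides are the integrals of F over the simplex s < v < u ≤ t in the two orders.
    let F : ℝ → ℝ → ℝ := fun v u => if s < v ∧ v < u ∧ u ≤ t then
      gl v * (gj u * (signatureCoord T X A v u * signatureCoord T X B u t)) else 0
    have hFm : Measurable (Function.uncurry F) := by
      refine Measurable.ite ?_ ?_ measurable_const
      · exact (measurableSet_lt measurable_const measurable_fst).inter
          ((measurableSet_lt measurable_fst measurable_snd).inter
            (measurableSet_le measurable_snd measurable_const))
      · have h1 : Measurable fun p : ℝ × ℝ => signatureCoord T X A p.1 p.2 :=
          (stronglyMeasurable_signatureCoord A).measurable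
        have h2 : Measurable fun p : ℝ × ℝ => signatureCoord T X B p.2 t :=
          (measurable_signatureCoord_left B t).comp measurable_snd
        exact ((measurable_signDensity _).comp measurable_fst).mul
          (((measurable_signDensity _).comp measurable_snd).mul (h1.mul h2))
    have hFi : Integrable (Function.uncurry F) (νl.prod νj) := by
      refine Integrable.of_bound (C := ((sumVariation T X).real univ ^ A.length /
        (A.length.factorial : ℝ)) * ((sumVariation T X).real univ ^ B.length /
        (B.length.factorial : ℝ))) hFm.aestronglyMeasurable (.of_forall fun p => ?_)
      simp only [Function.uncurry, F]
      split_ifs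
      · simp only [norm_mul, Real.norm_eq_abs, gl, gj, abs_signDensity, one_mul]
        exact mul_le_mul (abs_signatureCoord_le _ _ _) (abs_signatureCoord_le _ _ _)
          (abs_nonneg _) (by positivity)
      · rw [norm_zero]
        positivity
    have hswap := integral_integral_swap hFi
    have hleft : ∫ v in Ioc s t, gl v * signatureCoord T X (A ++ j :: B) v t ∂νl =
        ∫ v, ∫ u, F v u ∂νj ∂νl := by
      rw [← integral_indicator measurableSet_Ioc]
      congr 1
      funext v
      by_cases hv : v ∈ Ioc s t
      · rw [indicator_of_mem hv, ih, ← integral_const_mul, ← integral_indicator measurableSet_Ioc]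
        congr 1
        funext u
        simp only [F, indicator, mem_Ioc, hv.1, true_and]
      · rw [indicator_of_notMem hv]
        have : ∀ u, F v u = 0 := fun u => if_neg fun h => hv ⟨h.1, h.2.1.le.trans h.2.2⟩
        simp [this]
    have hright : ∫ u in Ioc s t, gj u *
        (signatureCoord T X (l :: A) s u * signatureCoord T X B u t) ∂νj =
        ∫ u, ∫ v, F v u ∂νl ∂νj := by
      rw [← integral_indicator measurableSet_Ioc]
      congr 1
      funext u
      by_cases hu : u ∈ Ioc s t
      · have := hν l
        rw [indicator_of_mem hu, signatureCoord_cons, integral_Ioc_eq_integral_Ioo,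
          mul_comm (∫ _ in _, _ ∂_), ← mul_assoc, ← integral_const_mul,
          ← integral_indicator measurableSet_Ioo]
        congr 1
        funext v
        simp only [F, indicator, mem_Ioo, hu.2, and_true]
        split_ifs
        · ring
        · rfl
      · rw [indicator_of_notMem hu]
        have : ∀ v, F v u = 0 := fun v => if_neg fun h => hu ⟨h.1.trans h.2.1, h.2.2⟩
        simp [this]
    rw [hleft, hright, hswap]

/-! ### Series of iterated integrals -/

theorem summable_pow_length_div_factorial (R : ℝ) (hR : 0 ≤ R) :
    Summable fun L : List (Fin d) => R ^ L.length / (L.length.factorial : ℝ) := by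
  rw [← (Equiv.sigmaFiberEquiv (List.length (α := Fin d))).summable_iff, summable_sigma_of_nonneg]
  · refine ⟨fun n => ?_, ?_⟩
    · have : Finite {L : List (Fin d) // L.length = n} := inferInstanceAs (Finite (List.Vector _ n))
      exact Summable.of_finite
    · have h : ∀ n : ℕ, ∑' L : {L : List (Fin d) // L.length = n},
          ((fun L : List (Fin d) => R ^ L.length / (L.length.factorial : ℝ)) ∘
            Equiv.sigmaFiberEquiv (List.length (α := Fin d))) ⟨n, L⟩ =
          (d * R) ^ n / (n.factorial : ℝ) := by
        intro n
        have h1 : ∀ L : {L : List (Fin d) // L.length = n},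
            ((fun L : List (Fin d) => R ^ L.length / (L.length.factorial : ℝ)) ∘
              Equiv.sigmaFiberEquiv (List.length (α := Fin d))) ⟨n, L⟩ =
            R ^ n / (n.factorial : ℝ) := by
          rintro ⟨L, rfl⟩
          rfl
        simp only [h1, tsum_const, nsmul_eq_mul]
        have : Nat.card {L : List (Fin d) // L.length = n} = d ^ n := by
          change Nat.card (List.Vector (Fin d) n) = _
          rw [Nat.card_eq_fintype_card, card_vector, Fintype.card_fin]
        rw [this, mul_pow]
        push_cast
        ring
      simp only [h]
      exact Real.summable_pow_div_factorial _
  · intro x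
    simp only [Function.comp_apply]
    positivity

variable (T X) in
/-- The series `∑_L c(L) S^{(L)}_{s,t}`. -/
noncomputable def signatureSeries (c : List (Fin d) → ℂ) (s t : ℝ) : ℂ :=
  ∑' L, c L * (signatureCoord T X L s t : ℂ)

/-- The bound does not depend on s and t, as needed for dominated convergence. -/
theorem ExpBounded.exists_summable_bound {c : List (Fin d) → ℂ} (hc : ExpBounded c) (T : ℝ)
    (X : ℝ → EuclideanSpace ℝ (Fin d)) :
    ∃ b : List (Fin d) → ℝ, Summable b ∧
      ∀ L s t, ‖c L * (signatureCoord T X L s t : ℂ)‖ ≤ b L := by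
  obtain ⟨C, R, hC, hR, h⟩ := hc
  refine ⟨fun L => C * ((R * (sumVariation T X).real univ) ^ L.length /
    (L.length.factorial : ℝ)), (summable_pow_length_div_factorial _ (by positivity)).mul_left C,
    fun L s t => ?_⟩
  rw [norm_mul, Complex.norm_real, Real.norm_eq_abs]
  refine (mul_le_mul (h L) (abs_signatureCoord_le L s t) (abs_nonneg _) (by positivity)).trans_eq ?_
  simp only [mul_pow]
  ring

theorem ExpBounded.summable {c : List (Fin d) → ℂ} (hc : ExpBounded c) (s t : ℝ) :
    Summable fun L => c L * (signatureCoord T X L s t : ℂ) := by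
  obtain ⟨b, hb, h⟩ := hc.exists_summable_bound T X
  exact Summable.of_norm_bounded hb fun L => h L s t

theorem ExpBounded.exists_norm_signatureSeries_le {c : List (Fin d) → ℂ} (hc : ExpBounded c)
    (T : ℝ) (X : ℝ → EuclideanSpace ℝ (Fin d)) :
    ∃ C, 0 ≤ C ∧ ∀ s t, ‖signatureSeries T X c s t‖ ≤ C := by
  obtain ⟨b, hb, h⟩ := hc.exists_summable_bound T X
  refine ⟨∑' L, b L, tsum_nonneg fun L => (norm_nonneg _).trans (h L 0 0), fun s t => ?_⟩
  exact tsum_of_norm_bounded hb.hasSum fun L => h L s t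

theorem ExpBounded.stronglyMeasurable_signatureSeries {c : List (Fin d) → ℂ} (hc : ExpBounded c) :
    StronglyMeasurable fun p : ℝ × ℝ => signatureSeries T X c p.1 p.2 := by
  refine StronglyMeasurable.hasSum (f := fun L (p : ℝ × ℝ) =>
    c L * (signatureCoord T X L p.1 p.2 : ℂ)) (fun L => ?_) fun p => (hc.summable p.1 p.2).hasSum
  exact stronglyMeasurable_const.mul
    (Complex.continuous_ofReal.comp_stronglyMeasurable (stronglyMeasurable_signatureCoord L))

theorem ExpBounded.integrableOn_mul {c c' : List (Fin d) → ℂ} (hc : ExpBounded c)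
    (hc' : ExpBounded c') (j : Fin d) (s t : ℝ) :
    (coordMeasure T X j).IntegrableOn
      (fun u => signatureSeries T X c s u * signatureSeries T X c' u t) (Ioc s t) := by
  obtain ⟨C, hC, h⟩ := hc.exists_norm_signatureSeries_le T X
  obtain ⟨C', hC', h'⟩ := hc'.exists_norm_signatureSeries_le T X
  rw [VectorMeasure.IntegrableOn, VectorMeasure.Integrable,
    VectorMeasure.variation_restrict measurableSet_Ioc]
  refine Integrable.of_bound (C := C * C') ?_ (.of_forall fun u => ?_)
  · refine StronglyMeasurable.aestronglyMeasurable (StronglyMeasurable.mul ?_ ?_)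
    · exact hc.stronglyMeasurable_signatureSeries.comp_measurable
        (by fun_prop : Measurable fun u : ℝ => (s, u))
    · exact hc'.stronglyMeasurable_signatureSeries.comp_measurable
        (by fun_prop : Measurable fun u : ℝ => (u, t))
  · rw [norm_mul]
    exact mul_le_mul (h _ _) (h' _ _) (norm_nonneg _) hC

theorem integrableOn_signatureCoord (j : Fin d) (J : List (Fin d)) (s t : ℝ) :
    (coordMeasure T X j).IntegrableOn (fun u => signatureCoord T X J u t) (Ioc s t) := by
  rw [VectorMeasure.IntegrableOn, VectorMeasure.Integrable,
    VectorMeasure.variation_restrict measurableSet_Ioc]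
  exact Integrable.of_bound (measurable_signatureCoord_left J t).aestronglyMeasurable _
    (.of_forall fun u => abs_signatureCoord_le J u t)

/-- The pairs (A,B) are grouped by the word L = A j B; the fibre over L is the finite set
`wordSplits j L`. -/
theorem tsum_wordConv {c c' : List (Fin d) → ℂ} (j : Fin d) (f : List (Fin d) → ℂ)
    (h : Summable fun p : List (Fin d) × List (Fin d) => c p.1 * c' p.2 * f (p.1 ++ j :: p.2)) :
    ∑' p : List (Fin d) × List (Fin d), c p.1 * c' p.2 * f (p.1 ++ j :: p.2) =
      ∑' L, wordConv j c c' L * f L := by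
  have h2 := h.hasSum
  rw [← (Equiv.sigmaFiberEquiv fun p : List (Fin d) × List (Fin d) =>
    p.1 ++ j :: p.2).hasSum_iff] at h2
  refine (h2.sigma fun L => ?_).tsum_eq.symm
  let e : {p : List (Fin d) × List (Fin d) // p.1 ++ j :: p.2 = L} ≃ wordSplits j L :=
    Equiv.subtypeEquivRight fun p => mem_wordSplits.symm
  rw [← e.symm.hasSum_iff]
  have := (wordSplits j L).hasSum (fun p => c p.1 * c' p.2 * f L)
  rw [← Finset.sum_mul] at this
  convert! this using 1
  funext ⟨p, hp⟩
  change c p.1 * c' p.2 * f (p.1 ++ j :: p.2) = c p.1 * c' p.2 * f L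
  rw [mem_wordSplits.1 hp]

theorem integral_signatureSeries_mul
    (hν : ∀ j : Fin d, NullSingletonClass (coordMeasure T X j).variation)
    {c c' : List (Fin d) → ℂ} (hc : ExpBounded c) (hc' : ExpBounded c') (j : Fin d) (s t : ℝ) :
    ∫ᵛ u in Ioc s t, (signatureSeries T X c s u * signatureSeries T X c' u t)
        ∂<•(coordMeasure T X j) =
      signatureSeries T X (wordConv j c c') s t := by
  obtain ⟨b, hb, h⟩ := hc.exists_summable_bound T X
  obtain ⟨b', hb', h'⟩ := hc'.exists_summable_bound T X
  have hb0 : ∀ L, 0 ≤ b L := fun L => (norm_nonneg _).trans (h L 0 0)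
  have hb0' : ∀ L, 0 ≤ b' L := fun L => (norm_nonneg _).trans (h' L 0 0)
  set ν := (coordMeasure T X j).variation
  set g := signDensity (coordMeasure T X j)
  have hbb : Summable fun p : List (Fin d) × List (Fin d) => b p.1 * b' p.2 :=
    hb.mul_of_nonneg hb' hb0 hb0'
  have hterm : ∀ p : List (Fin d) × List (Fin d),
      ∫ u in Ioc s t, g u • ((c p.1 * (signatureCoord T X p.1 s u : ℂ)) *
        (c' p.2 * (signatureCoord T X p.2 u t : ℂ))) ∂ν =
      c p.1 * c' p.2 * (signatureCoord T X (p.1 ++ j :: p.2) s t : ℂ) := by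
    intro p
    rw [signatureCoord_append_cons hν, ← integral_complex_ofReal, ← integral_const_mul]
    congr 1
    funext u
    rw [Complex.real_smul]
    push_cast
    ring
  have hsum : HasSum (fun p : List (Fin d) × List (Fin d) =>
      c p.1 * c' p.2 * (signatureCoord T X (p.1 ++ j :: p.2) s t : ℂ))
      (∫ u in Ioc s t, g u • (signatureSeries T X c s u * signatureSeries T X c' u t) ∂ν) := by
    simp only [← hterm]
    refine hasSum_integral_of_dominated_convergence (fun p _ => b p.1 * b' p.2) (fun p => ?_)
      (fun p => .of_forall fun u => ?_) (.of_forall fun _ => hbb) (integrable_const _)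
      (.of_forall fun u => ?_)
    · refine Measurable.aestronglyMeasurable ?_
      have h1 := measurable_signatureCoord_right (T := T) (X := X) p.1 s
      have h2 := measurable_signatureCoord_left (T := T) (X := X) p.2 t
      have h3 := measurable_signDensity (coordMeasure T X j)
      exact h3.smul ((measurable_const.mul (Complex.measurable_ofReal.comp h1)).mul
        (measurable_const.mul (Complex.measurable_ofReal.comp h2)))
    · rw [norm_smul, Real.norm_eq_abs, abs_signDensity, one_mul, norm_mul]
      exact mul_le_mul (h _ _ _) (h' _ _ _) (norm_nonneg _) (hb0 _)
    · refine HasSum.const_smul _ ?_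
      have h1 := (hb.of_nonneg_of_le (fun _ => norm_nonneg _) fun L => h L s u)
      have h2 := (hb'.of_nonneg_of_le (fun _ => norm_nonneg _) fun L => h' L u t)
      have := summable_mul_of_summable_norm h1 h2
      rw [signatureSeries, signatureSeries, tsum_mul_tsum_of_summable_norm h1 h2]
      exact this.hasSum
  rw [setIntegral_signedMeasure_eq _ _ measurableSet_Ioc, ← hsum.tsum_eq, signatureSeries]
  exact tsum_wordConv j (fun L => (signatureCoord T X L s t : ℂ)) hsum.summable

end Signature

/-! ### From coefficient identities to the kernel components -/

section Main

variable {d : ℕ} {T : ℝ} {X : ℝ → EuclideanSpace ℝ (Fin d)} {φ : List (Fin d) → ℂ}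

theorem sdKernel_eq_signatureSeries (s t : ℝ) :
    sdKernel φ T X s t = signatureSeries T X (kernelCoeff φ) s t := rfl

/-- The auxiliary c carries no sign, like `sdIterated`, whereas `auxCoeff` has one factor -1 per
letter. -/
theorem exists_sdIterated_eq_signatureSeries
    (hν : ∀ j : Fin d, NullSingletonClass (coordMeasure T X j).variation)
    (hφ : ExpBounded (kernelCoeff φ)) (J : List (Fin d)) :
    ∃ c, ExpBounded c ∧ (∀ L, auxCoeff (kernelCoeff φ) J L = (-1) ^ J.length * c L) ∧
      ∀ s t, sdIterated φ T X J s t = signatureSeries T X c s t := by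
  induction J with
  | nil => exact ⟨kernelCoeff φ, hφ, fun L => by simp [auxCoeff], fun s t => rfl⟩
  | cons j J ih =>
    obtain ⟨c, hc, hcoeff, hser⟩ := ih
    refine ⟨wordConv j (kernelCoeff φ) c, hφ.wordConv hc j, fun L => ?_, fun s t => ?_⟩
    · have : auxCoeff (kernelCoeff φ) J = fun L => (-1) ^ J.length * c L := funext hcoeff
      simp only [auxCoeff, this, wordConv_mul_right, List.length_cons]
      ring
    · rw [sdIterated, ← integral_signatureSeries_mul hν hφ hc]
      simp only [hser, sdKernel_eq_signatureSeries]

theorem sdAux_eq_signatureSeries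
    (hν : ∀ j : Fin d, NullSingletonClass (coordMeasure T X j).variation)
    (hφ : ExpBounded (kernelCoeff φ)) (J : List (Fin d)) (s t : ℝ) :
    sdAux φ T X J s t = signatureSeries T X (auxCoeff (kernelCoeff φ) J) s t := by
  obtain ⟨c, -, hcoeff, hser⟩ := exists_sdIterated_eq_signatureSeries hν hφ J
  rw [sdAux, hser, signatureSeries, signatureSeries, ← tsum_mul_left]
  exact tsum_congr fun L => by rw [hcoeff, mul_assoc]

theorem sdComponentTerm_nil (I : List (Fin d)) (s t : ℝ) (L : List (Fin d)) :
    sdComponentTerm φ T X [] I s t L =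
      kernelCoeff φ (I ++ L) * (signatureCoord T X L s t : ℂ) := by
  simp [sdComponentTerm, kernelCoeff, add_comm]

/-- A representation of the coefficients `i^{|I| + |L|} φ(I L)` as a finite combination of the
coefficients of the `K_J` gives the corresponding representation of `K^{(I)}`. -/
theorem sdComponent_eq_sum
    (hν : ∀ j : Fin d, NullSingletonClass (coordMeasure T X j).variation)
    (hφ : ExpBounded (kernelCoeff φ)) {κ : Type*} (S : Finset κ) (w : κ → ℂ)
    (J : κ → List (Fin d)) {I : List (Fin d)}
    (h : ∀ L, kernelCoeff φ (I ++ L) = ∑ x ∈ S, w x * auxCoeff (kernelCoeff φ) (J x) L)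
    (s t : ℝ) :
    Summable (sdComponentTerm φ T X [] I s t) ∧
      sdComponent φ T X [] I s t = ∑ x ∈ S, w x * sdAux φ T X (J x) s t := by
  have hsum : HasSum (fun L => ∑ x ∈ S, w x * (auxCoeff (kernelCoeff φ) (J x) L *
      (signatureCoord T X L s t : ℂ))) (∑ x ∈ S, w x * sdAux φ T X (J x) s t) := by
    refine hasSum_sum fun x _ => ?_
    rw [sdAux_eq_signatureSeries hν hφ]
    exact ((hφ.auxCoeff (J x)).summable s t).hasSum.mul_left _
  have heq : sdComponentTerm φ T X [] I s t = fun L => ∑ x ∈ S, w x *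
      (auxCoeff (kernelCoeff φ) (J x) L * (signatureCoord T X L s t : ℂ)) := by
    funext L
    rw [sdComponentTerm_nil, h, Finset.sum_mul]
    exact Finset.sum_congr rfl fun x _ => by ring
  rw [sdComponent, heq]
  exact ⟨hsum.summable, hsum.tsum_eq⟩

end Main

theorem mainTheorem9
    {A : Type*} [Ring A] [Algebra ℂ A] (τ : A →ₗ[ℂ] ℂ) (hτ : τ 1 = 1)
    {d : ℕ} (a : Fin d → A) (ha : ∀ i, IsStandardSemicircular τ (a i)) (hfree : AreFree τ a)
    (T : ℝ) (X : ℝ → EuclideanSpace ℝ (Fin d))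
    (hXc : ContinuousOn X (Icc 0 T)) (hX : BoundedVariationOn X (Icc 0 T)) :
    -- all iterated integrals are integrals of integrable functions
    (∀ s t : ℝ, 0 ≤ s → s ≤ t → t ≤ T → ∀ (j : Fin d) (J : List (Fin d)),
      (coordMeasure T X j).IntegrableOn (fun u => signatureCoord T X J u t) (Ioc s t) ∧
      (coordMeasure T X j).IntegrableOn
        (fun u => sdKernel (jointMoment τ a) T X s u * sdIterated (jointMoment τ a) T X J u t)
        (Ioc s t)) ∧
    -- for every word `I`, the series of `K^{(I)}` converges absolutely, and both forms of the
    -- combinatorial formula hold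
    (∀ s t : ℝ, 0 ≤ s → s ≤ t → t ≤ T → ∀ I : List (Fin d),
      Summable (sdComponentTerm (jointMoment τ a) T X [] I s t) ∧
      sdComponent (jointMoment τ a) T X [] I s t =
        ∑ π ∈ partialMatchingsNC I.length,
          matchingWeight I π * sdAux (jointMoment τ a) T X (unmatchedWord I π).reverse s t ∧
      sdComponent (jointMoment τ a) T X [] I.reverse s t =
        ∑ π ∈ partialMatchingsNC I.length,
          matchingWeight I π * sdAux (jointMoment τ a) T X (unmatchedWord I π) s t) := by
  have hφ := expBounded_kernelCoeff hτ ha hfree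
  have hk := kernelCoeff_nil (a := a) hτ
  have hl := kernelCoeff_cons hτ ha hfree
  have hr := kernelCoeff_append_singleton hτ ha hfree
  constructor
  · intro s t hs hst ht j J
    have hν := nullSingletonClass_variation_coordMeasure (hs.trans (hst.trans ht)) hXc
    refine ⟨integrableOn_signatureCoord j J s t, ?_⟩
    obtain ⟨c, hc, -, hser⟩ := exists_sdIterated_eq_signatureSeries hν hφ J
    simp only [hser, sdKernel_eq_signatureSeries]
    exact hφ.integrableOn_mul hc j s t
  · intro s t hs hst ht I
    have hν := nullSingletonClass_variation_coordMeasure (hs.trans (hst.trans ht)) hXc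
    have h1 := sdComponent_eq_sum hν hφ _ _ _ (coeff_append_eq_sum hk hl I) s t
    exact ⟨h1.1, h1.2,
      (sdComponent_eq_sum hν hφ _ _ _ (coeff_reverse_append_eq_sum hk hl hr I) s t).2⟩
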